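/- Let $G=(V,E)$ be a finite simple graph none of whose connected components is isomorphic to $K_2$ (the complete graph on two vertices). Then there exists an edge-weighting $\omega:E\to\{1,2,3\}$ such that for each edge $\{v,w\}\in E$, $$\sum_{u\in N(v)}\omega(\{u,v\})\neq\sum_{u\in N(w)}\omega(\{u,w\}),$$ where $N(x)$ denotes the set of neighbors of the vertex $x$ in $G$. -/

import Mathlib

/-- The weighted degree of the vertex `v` under the edge-weighting `ω`: the sum of the weights
`ω {v, u}` over all neighbors `u` of `v`. -/
def weightedDegree {V : Type*} [Fintype V] (G : SimpleGraph V) [DecidableRel G.Adj]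
    (ω : G.edgeSet → ℕ) (v : V) : ℕ :=
  ∑ u : G.neighborSet v, ω ⟨s(v, (u : V)), G.mem_edgeSet.mpr u.2⟩

/-!
A connected graph has an independent set `R` such that the edges between `R` and its complement
already connect all vertices (`exists_max_independent`). The aim is that the weighted degrees are
even on `R` and odd off `R`, which leaves only the conflicts between vertices off `R`.

These are settled by `exists_odd_proper_weighting`. In the graph induced off `R`, take a maximal cut
and aim at weighted degrees 1 modulo 4 on one side and 3 modulo 4 on the other. The edges inside the
two sides get weight 1 or 3, the edges of the cut get weight 2 up to a correction by at most 1; by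
max-flow min-cut (`exists_flow`), maximality of the cut is just what is needed to correct the
deviations from a greedy colouring. This asks for a certain odd residue modulo 4 of the contribution
of the edges towards `R`, and each vertex off `R` has an edge of odd weight to `R` on which 1 and 3
can be interchanged for that purpose, without effect on the parities (`exists_weighting_of_parity`).

Parities of edge weights between `R` and its complement with the desired sums at all vertices exist
if the number of vertices off `R` is even, by connectedness (`exists_bdry_eq`). If it is odd, then
one vertex needs the wrong parity. A leaf of the graph, taken as the root in `R`, is such a vertex,
since its weighted degree is smaller than that of its neighbour, the graph not being `K₂`
(`exists_solution_of_even_or_leaf`). In a graph without leaves, a vertex `v` off `R` is made even.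
Its conflicts with neighbours in `R` can be resolved in several situations:
* `v` has two neighbours in `R`, and all edges from `v` to `R` are odd
  (`exists_solution_of_all_odd`);
* `v` has one neighbour in `R` and lies in a triangle with it (`exists_solution_of_triangle`);
* `v` has one neighbour `r` in `R`, and `r` has an odd edge to another vertex without neighbours off
  `R` (`exists_solution_of_helper`);
* `v` has no neighbours off `R`, and exchanges its role with a neighbour in `R`
  (`exists_solution_of_exchange`).
The odd edges these situations need are prescribed at a few vertices, and the remaining parities are
adjusted as before, if removing these vertices does not disconnect the edges between `R` and its
complement (`exists_bdry_eq_extending`). Looking at the vertices farthest from a root, and for `R`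
of maximal size, one of these situations always occurs (`Layered.exists_solution`).
-/

namespace OneTwoThree

open Finset
open scoped Classical

/-! ### Flows and maximal cuts -/

section CutFlow

variable {V : Type*}

/-- The indicator function of a finite set, with integer values. -/
noncomputable def ind (U : Finset V) (v : V) : ℤ := if v ∈ U then 1 else 0

theorem abs_ind_sub_submodular (U W : Finset V) (x y : V) :
    |ind (U ∩ W) x - ind (U ∩ W) y| + |ind (U ∪ W) x - ind (U ∪ W) y| ≤
      |ind U x - ind U y| + |ind W x - ind W y| := by
  unfold ind
  by_cases h1 : x ∈ U <;> by_cases h2 : x ∈ W <;> by_cases h3 : y ∈ U <;> by_cases h4 : y ∈ W <;>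
    simp [h1, h2, h3, h4]

theorem sum_mul_ind_sub [Fintype V] (g : V → ℤ) (x : ℤ) (a b : V) (U : Finset V) :
    ∑ v ∈ U, (g v - x * ((if a = v then 1 else 0) - (if b = v then 1 else 0))) =
      ∑ v ∈ U, g v - x * (ind U a - ind U b) := by
  rw [Finset.sum_sub_distrib, ← Finset.mul_sum, Finset.sum_sub_distrib]
  simp [ind]

/-- Max-flow min-cut for unit capacities and integral net outflow `g`: if no set `U` has to send out
more than the number of edges leaving it, then a flow with values in `{-1, 0, 1}` exists. Edges are
fixed one at a time; a value of the flow on `e` that violates no set `U` exists by submodularity of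
the cut function. -/
theorem exists_flow [Fintype V] (E : Finset (V × V)) : ∀ g : V → ℤ, ∑ v, g v = 0 →
    (∀ U : Finset V, ∑ v ∈ U, g v ≤ ∑ p ∈ E, |ind U p.1 - ind U p.2|) →
    ∃ f : V × V → ℤ, (∀ p, |f p| ≤ 1) ∧
      ∀ v, g v = ∑ p ∈ E, f p * ((if p.1 = v then 1 else 0) - (if p.2 = v then 1 else 0)) := by
  induction E using Finset.induction_on with
  | empty =>
    intro g h0 hU
    refine ⟨fun _ => 0, by simp, fun v => ?_⟩
    have hle : ∀ v ∈ (univ : Finset V), g v ≤ 0 := fun v _ => by simpa using hU {v}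
    simpa using (Finset.sum_eq_zero_iff_of_nonpos hle).1 h0 v (mem_univ v)
  | insert e E he ih =>
    intro g h0 hU
    simp only [Finset.sum_insert he] at hU
    set cap : Finset V → ℤ := fun U => ∑ p ∈ E, |ind U p.1 - ind U p.2| with hcap
    -- Sets that need a unit of flow through `e` forwards exclude sets that need one backwards.
    have key : ∀ U W : Finset V, e.1 ∈ U → e.2 ∉ U → e.2 ∈ W → e.1 ∉ W →
        ∑ v ∈ U, g v + ∑ v ∈ W, g v ≤ cap U + cap W := by
      intro U W h1 h2 h3 h4
      have hi := hU (U ∩ W)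
      have hu := hU (U ∪ W)
      simp only [ind, mem_inter, mem_union, h1, h2, h3, h4] at hi hu
      have hs := Finset.sum_union_inter (s₁ := U) (s₂ := W) (f := g)
      have hc : cap (U ∩ W) + cap (U ∪ W) ≤ cap U + cap W := by
        simp only [hcap, ← Finset.sum_add_distrib]
        exact Finset.sum_le_sum fun p _ => abs_ind_sub_submodular U W p.1 p.2
      simp only [hcap, ind, mem_inter, mem_union] at hc ⊢
      simp only [and_false, false_and, or_true, true_or, if_true, if_false, sub_self,
        abs_zero, zero_add] at hi hu
      linarith
    obtain ⟨x, hx, hxU⟩ : ∃ x : ℤ, |x| ≤ 1 ∧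
        ∀ U : Finset V, ∑ v ∈ U, g v - x * (ind U e.1 - ind U e.2) ≤ cap U := by
      by_cases c1 : ∃ U : Finset V, e.1 ∈ U ∧ e.2 ∉ U ∧ cap U < ∑ v ∈ U, g v
      · obtain ⟨U, h1, h2, hlt⟩ := c1
        refine ⟨1, by simp, fun W => ?_⟩
        have hW := hU W
        change _ ≤ _ + cap W at hW
        by_cases h3 : e.1 ∈ W <;> by_cases h4 : e.2 ∈ W
        · simp only [ind, h3, h4, if_true, sub_self, abs_zero] at hW ⊢; linarith
        · simp only [ind, h3, h4, if_true, if_false, sub_zero, abs_one] at hW ⊢; linarith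
        · have := key U W h1 h2 h4 h3
          simp only [ind, h3, h4, if_true, if_false]; linarith
        · simp only [ind, h3, h4, if_false, sub_self, abs_zero] at hW ⊢; linarith
      by_cases c2 : ∃ W : Finset V, e.2 ∈ W ∧ e.1 ∉ W ∧ cap W < ∑ v ∈ W, g v
      · obtain ⟨W, h1, h2, hlt⟩ := c2
        refine ⟨-1, by simp, fun U => ?_⟩
        have hW := hU U
        change _ ≤ _ + cap U at hW
        by_cases h3 : e.1 ∈ U <;> by_cases h4 : e.2 ∈ U
        · simp only [ind, h3, h4, if_true, sub_self, abs_zero] at hW ⊢; linarith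
        · have := key U W h3 h4 h1 h2
          simp only [ind, h3, h4, if_true, if_false]; linarith
        · simp only [ind, h3, h4, if_true, if_false, zero_sub, abs_neg, abs_one] at hW ⊢; linarith
        · simp only [ind, h3, h4, if_false, sub_self, abs_zero] at hW ⊢; linarith
      · refine ⟨0, by simp, fun U => ?_⟩
        push Not at c1 c2
        have hW := hU U
        change _ ≤ _ + cap U at hW
        by_cases h3 : e.1 ∈ U <;> by_cases h4 : e.2 ∈ U
        · simp only [ind, h3, h4, if_true, sub_self, abs_zero] at hW ⊢; linarith
        · have := c1 U h3 h4; linarith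
        · have := c2 U h4 h3; linarith
        · simp only [ind, h3, h4, if_false, sub_self, abs_zero] at hW ⊢; linarith
    obtain ⟨f, hf, hfg⟩ := ih
      (fun v => g v - x * ((if e.1 = v then 1 else 0) - (if e.2 = v then 1 else 0)))
      (by rw [sum_mul_ind_sub, h0]; simp [ind])
      (fun U => by rw [sum_mul_ind_sub]; exact hxU U)
    refine ⟨Function.update f e x, fun p => ?_, fun v => ?_⟩
    · by_cases hp : p = e
      · subst hp; simpa using hx
      · simpa [hp] using hf p
    · rw [Finset.sum_insert he, Function.update_self]
      have : ∑ p ∈ E, Function.update f e x p *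
          ((if p.1 = v then 1 else 0) - (if p.2 = v then 1 else 0)) =
          ∑ p ∈ E, f p * ((if p.1 = v then 1 else 0) - (if p.2 = v then 1 else 0)) :=
        Finset.sum_congr rfl fun p hp => by
          rw [Function.update_of_ne (ne_of_mem_of_not_mem hp he)]
      rw [this, ← hfg v]; ring

/-- For a cut `S` maximising the number of edges across it, switching the sides of all vertices of
`U` shows that at least as many edges of the cut leave `U` as edges inside the two sides do. Sums
run over ordered pairs. -/
theorem exists_max_cut [Fintype V] (Γ : SimpleGraph V) : ∃ S : Finset V, ∀ U : Finset V,
    ∑ x, ∑ y, (if Γ.Adj x y ∧ (x ∈ S ↔ y ∈ S) then |ind U x - ind U y| else 0) ≤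
    ∑ x, ∑ y, (if Γ.Adj x y ∧ ¬ (x ∈ S ↔ y ∈ S) then |ind U x - ind U y| else 0) := by
  obtain ⟨S, -, hS⟩ := Finset.exists_max_image (univ : Finset (Finset V))
    (fun S => ∑ x, ∑ y, (if Γ.Adj x y ∧ ¬ (x ∈ S ↔ y ∈ S) then (1 : ℤ) else 0)) ⟨∅, mem_univ _⟩
  refine ⟨S, fun U => ?_⟩
  have h := hS (symmDiff S U) (mem_univ _)
  have e : ∀ x y, (if Γ.Adj x y ∧ ¬ (x ∈ symmDiff S U ↔ y ∈ symmDiff S U) then (1 : ℤ) else 0) +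
      (if Γ.Adj x y ∧ ¬ (x ∈ S ↔ y ∈ S) then |ind U x - ind U y| else 0) =
      (if Γ.Adj x y ∧ ¬ (x ∈ S ↔ y ∈ S) then (1 : ℤ) else 0) +
      (if Γ.Adj x y ∧ (x ∈ S ↔ y ∈ S) then |ind U x - ind U y| else 0) := by
    intro x y
    simp only [ind, Finset.mem_symmDiff]
    by_cases h0 : Γ.Adj x y <;> by_cases h1 : x ∈ S <;> by_cases h2 : y ∈ S <;>
      by_cases h3 : x ∈ U <;> by_cases h4 : y ∈ U <;> simp [h0, h1, h2, h3, h4]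
  have := Finset.sum_congr (rfl : (univ : Finset V) = univ) fun x _ =>
    Finset.sum_congr (rfl : (univ : Finset V) = univ) fun y _ => e x y
  simp only [Finset.sum_add_distrib] at this h
  linarith

end CutFlow

/-! ### Balancing across a cut, and greedy colouring -/

section CutBalance

variable {V : Type*}

theorem two_mul_sum_eq_of_antisymm [Fintype V] (a : V → V → ℤ) (ha : ∀ x y, a x y = - a y x)
    (U : Finset V) :
    2 * ∑ v ∈ U, ∑ u, a v u = ∑ v, ∑ u, (ind U v - ind U u) * a v u := by
  have h1 : ∑ v ∈ U, ∑ u, a v u = ∑ v, ∑ u, ind U v * a v u := by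
    rw [← Finset.univ_inter U, ← Finset.sum_ite_mem, Finset.univ_inter]
    refine Finset.sum_congr rfl fun v _ => ?_
    by_cases hv : v ∈ U <;> simp [ind, hv]
  have h2 : ∑ v, ∑ u, ind U v * a v u = - ∑ v, ∑ u, ind U u * a v u := by
    rw [Finset.sum_comm, ← Finset.sum_neg_distrib]
    refine Finset.sum_congr rfl fun x _ => ?_
    rw [← Finset.sum_neg_distrib]
    exact Finset.sum_congr rfl fun y _ => by rw [ha y x]; ring
  simp only [sub_mul, Finset.sum_sub_distrib]
  rw [h1]; linarith

/-- With a maximal cut `S`, an antisymmetric function `ε` with values in `{-1, 0, 1}` on the edges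
inside the two sides can be balanced by a symmetric function `φ` with values in `{-1, 0, 1}` on the
edges of the cut. With a sign change on one side of the cut, `φ` becomes a flow, and the cut
condition of `exists_flow` is `exists_max_cut`. -/
theorem exists_cut_adjustment [Fintype V] (Γ : SimpleGraph V) (S : Finset V)
    (hS : ∀ U : Finset V,
      ∑ x, ∑ y, (if Γ.Adj x y ∧ (x ∈ S ↔ y ∈ S) then |ind U x - ind U y| else 0) ≤
      ∑ x, ∑ y, (if Γ.Adj x y ∧ ¬ (x ∈ S ↔ y ∈ S) then |ind U x - ind U y| else 0))
    (ε : V → V → ℤ) (hε : ∀ x y, ε x y = - ε y x) (hε1 : ∀ x y, |ε x y| ≤ 1) :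
    ∃ φ : V → V → ℤ, (∀ x y, φ x y = φ y x) ∧ (∀ x y, |φ x y| ≤ 1) ∧
      ∀ v, ∑ u, (if Γ.Adj v u ∧ (v ∈ S ↔ u ∈ S) then ε v u else 0) =
        ∑ u, (if Γ.Adj v u ∧ ¬ (v ∈ S ↔ u ∈ S) then φ v u else 0) := by
  set σ : V → ℤ := fun v => if v ∈ S then 1 else -1 with hσ
  set a : V → V → ℤ := fun v u => if Γ.Adj v u ∧ (v ∈ S ↔ u ∈ S) then σ v * ε v u else 0 with ha
  have haa : ∀ x y, a x y = - a y x := by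
    intro x y
    simp only [ha, hσ, Γ.adj_comm y x, hε y x]
    by_cases h1 : x ∈ S <;> by_cases h2 : y ∈ S <;> by_cases h3 : Γ.Adj x y <;>
      simp [h1, h2, h3]
  set E : Finset (V × V) := univ.filter fun p => Γ.Adj p.1 p.2 ∧ p.1 ∈ S ∧ p.2 ∉ S with hE
  have hsumE : ∀ F : V → V → ℤ, ∑ p ∈ E, F p.1 p.2 =
      ∑ x, ∑ y, if Γ.Adj x y ∧ x ∈ S ∧ y ∉ S then F x y else 0 := by
    intro F
    rw [hE, Finset.sum_filter, Fintype.sum_prod_type]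
  have hcap : ∀ U : Finset V, 2 * ∑ p ∈ E, |ind U p.1 - ind U p.2| =
      ∑ x, ∑ y, (if Γ.Adj x y ∧ ¬ (x ∈ S ↔ y ∈ S) then |ind U x - ind U y| else 0) := by
    intro U
    rw [hsumE fun x y => |ind U x - ind U y|, two_mul]
    nth_rewrite 2 [Finset.sum_comm]
    simp only [← Finset.sum_add_distrib]
    refine Finset.sum_congr rfl fun x _ => Finset.sum_congr rfl fun y _ => ?_
    rw [abs_sub_comm (ind U y), Γ.adj_comm y x]
    by_cases h1 : x ∈ S <;> by_cases h2 : y ∈ S <;> by_cases h3 : Γ.Adj x y <;>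
      simp [h1, h2, h3]
  obtain ⟨f, hf, hfg⟩ := exists_flow E (fun v => ∑ u, a v u)
    (by
      have := two_mul_sum_eq_of_antisymm a haa univ
      simp only [ind, mem_univ, if_true, sub_self, zero_mul, Finset.sum_const_zero] at this
      linarith)
    (by
      intro U
      have h1 := two_mul_sum_eq_of_antisymm a haa U
      have h2 := hcap U
      have h3 := hS U
      have h4 : ∑ v, ∑ u, (ind U v - ind U u) * a v u ≤
          ∑ x, ∑ y, (if Γ.Adj x y ∧ (x ∈ S ↔ y ∈ S) then |ind U x - ind U y| else 0) := by
        refine Finset.sum_le_sum fun x _ => Finset.sum_le_sum fun y _ => ?_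
        simp only [ha]
        split_ifs with h
        · refine (le_abs_self _).trans ?_
          rw [abs_mul, abs_mul]
          have : |σ x| = 1 := by simp only [hσ]; split_ifs <;> simp
          rw [this, one_mul]
          exact mul_le_of_le_one_right (abs_nonneg _) (hε1 x y)
        · simp
      linarith)
  refine ⟨fun x y => if x ∈ S ∧ y ∉ S then f (x, y) else if y ∈ S ∧ x ∉ S then f (y, x) else 0,
    ?_, ?_, ?_⟩
  · intro x y
    by_cases h1 : x ∈ S <;> by_cases h2 : y ∈ S <;> simp [h1, h2]
  · intro x y
    dsimp only
    split_ifs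
    · exact hf _
    · exact hf _
    · simp
  · intro v
    have h := hfg v
    rw [hsumE fun x y => f (x, y) * ((if x = v then 1 else 0) - (if y = v then 1 else 0))] at h
    have h' : ∑ x, ∑ y, (if Γ.Adj x y ∧ x ∈ S ∧ y ∉ S then
          f (x, y) * ((if x = v then 1 else 0) - (if y = v then 1 else 0)) else 0) =
        ∑ y, (if Γ.Adj v y ∧ v ∈ S ∧ y ∉ S then f (v, y) else 0) -
        ∑ x, (if Γ.Adj x v ∧ x ∈ S ∧ v ∉ S then f (x, v) else 0) := by
      have e : ∀ x y, (if Γ.Adj x y ∧ x ∈ S ∧ y ∉ S then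
          f (x, y) * ((if x = v then 1 else 0) - (if y = v then 1 else 0)) else 0) =
          (if x = v then (if Γ.Adj x y ∧ x ∈ S ∧ y ∉ S then f (x, y) else 0) else 0) -
          (if y = v then (if Γ.Adj x y ∧ x ∈ S ∧ y ∉ S then f (x, y) else 0) else 0) := by
        intro x y
        split_ifs <;> simp
      simp only [e, Finset.sum_sub_distrib]
      congr 1
      · rw [Finset.sum_comm]; simp
      · simp
    rw [h'] at h
    simp only [ha] at h
    by_cases hv : v ∈ S
    · simp only [hσ, hv, if_true, one_mul, not_true, and_false, if_false, Finset.sum_const_zero,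
        sub_zero, true_and, true_iff] at h ⊢
      rw [h]
      refine Finset.sum_congr rfl fun u _ => ?_
      by_cases hu : u ∈ S <;> simp [hu]
    · simp only [hσ, hv, if_false, not_false_eq_true, and_true, false_and, and_false,
        Finset.sum_const_zero, zero_sub, false_iff, not_not, neg_mul, one_mul] at h ⊢
      have h2 := congrArg Neg.neg h
      rw [neg_neg, ← Finset.sum_neg_distrib] at h2
      refine (Finset.sum_congr rfl fun u _ => ?_).trans (h2.trans
        (Finset.sum_congr rfl fun u _ => ?_))
      · by_cases hu : u ∈ S <;> by_cases hvu : Γ.Adj v u <;> simp [hu, hvu]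
      · by_cases hu : u ∈ S <;> by_cases hvu : Γ.Adj v u <;> simp [hu, hvu, Γ.adj_comm u v]

/-- Greedy choice along an ordering of the vertices: if `N v` lists the earlier vertices that `v`
has to avoid, then one of the `#(N v) + 1` values `b v + 4 * k` is available to `v`. -/
theorem exists_greedy [Fintype V] (rank : V → ℕ) (N : V → Finset V)
    (hN : ∀ v, ∀ u ∈ N v, rank u < rank v) (b : V → ℤ) :
    ∃ k : V → ℕ, ∀ v, k v ≤ #(N v) ∧ ∀ u ∈ N v, b u + 4 * k u ≠ b v + 4 * k v := by
  have main : ∀ n : ℕ, ∃ k : V → ℕ, ∀ v, rank v < n →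
      k v ≤ #(N v) ∧ ∀ u ∈ N v, b u + 4 * k u ≠ b v + 4 * k v := by
    intro n
    induction n with
    | zero => exact ⟨fun _ => 0, by simp⟩
    | succ n ih =>
      obtain ⟨k, hk⟩ := ih
      have ex : ∀ v, ∃ m : ℕ, m ≤ #(N v) ∧ ∀ u ∈ N v, b u + 4 * k u ≠ b v + 4 * m := by
        intro v
        by_contra hcon
        push Not at hcon
        have hsub : (Finset.range (#(N v) + 1)).image (fun m : ℕ => b v + 4 * (m : ℤ)) ⊆
            (N v).image fun u => b u + 4 * (k u : ℤ) := by
          intro z hz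
          obtain ⟨m, hm, rfl⟩ := Finset.mem_image.1 hz
          obtain ⟨u, hu, he⟩ := hcon m (by simpa [Nat.lt_succ_iff] using hm)
          exact Finset.mem_image.2 ⟨u, hu, he⟩
        have h1 := Finset.card_le_card hsub
        rw [Finset.card_image_of_injective _ (fun x y h => by simpa using h),
          Finset.card_range] at h1
        have h2 := Finset.card_image_le (s := N v) (f := fun u => b u + 4 * (k u : ℤ))
        omega
      choose m hm1 hm2 using ex
      refine ⟨fun v => if rank v < n then k v else m v, fun v hv => ?_⟩
      by_cases h : rank v < n
      · refine ⟨by simpa [h] using (hk v h).1, fun u hu => ?_⟩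
        have hu' : rank u < n := (hN v u hu).trans h
        simpa [h, hu'] using (hk v h).2 u hu
      · refine ⟨by simpa [h] using hm1 v, fun u hu => ?_⟩
        have hu' : rank u < n := lt_of_lt_of_le (hN v u hu) (Nat.lt_succ_iff.1 hv)
        simpa [h, hu'] using hm2 v u hu
  obtain ⟨k, hk⟩ := main (univ.sup rank + 1)
  exact ⟨k, fun v => hk v (Nat.lt_succ_iff.2 (Finset.le_sup (mem_univ v)))⟩

end CutBalance

/-! ### Proper weightings with prescribed residues -/

section Residues

variable {V : Type*}

/-- The weighted degree of `v` for integer weights defined on all unordered pairs of vertices, of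
which only the edges of `G` count. -/
noncomputable def wdeg [Fintype V] (G : SimpleGraph V) (ω : Sym2 V → ℤ) (v : V) : ℤ :=
  ∑ u, if G.Adj v u then ω s(v, u) else 0

/-- Every graph has residues `τ v` modulo 4 such that, as soon as each vertex `v` receives an
external contribution `c v ≡ τ v`, weights from `{1, 2, 3}` on the edges make all totals odd and
distinct on adjacent vertices.

For a maximal cut `S`, the totals are made 1 modulo 4 on `S` and 3 modulo 4 off `S`, so that only
edges inside the two sides matter. Such an edge nominally counts 2 at its earlier end and 0 or 4 at
its later end, so the vertices can be coloured greedily. The actual weight, 1 or 3, is the mean of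
the two nominal values, and the differences are made up by changing the weight 2 of the edges of the
cut by at most 1. -/
theorem exists_odd_proper_weighting [Fintype V] (Γ : SimpleGraph V) :
    ∃ τ : V → ℤ, (∀ v, τ v % 2 = 1) ∧ ∀ c : V → ℤ, (∀ v, c v % 4 = τ v % 4) →
      ∃ ω : Sym2 V → ℤ, (∀ e, 1 ≤ ω e ∧ ω e ≤ 3) ∧ (∀ v, (c v + wdeg Γ ω v) % 2 = 1) ∧
        ∀ u v, Γ.Adj u v → c u + wdeg Γ ω u ≠ c v + wdeg Γ ω v := by
  obtain ⟨S, hS⟩ := exists_max_cut Γ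
  set rank : V → ℕ := fun v => (Fintype.equivFin V v : ℕ) with hrank
  have rank_inj : ∀ u v, rank u = rank v → u = v := fun u v h =>
    (Fintype.equivFin V).injective (Fin.ext h)
  -- `Bk v` consists of the earlier neighbours of `v` on the same side of the cut.
  set Bk : V → Finset V := fun v =>
    univ.filter fun u => Γ.Adj v u ∧ (v ∈ S ↔ u ∈ S) ∧ rank u < rank v with hBk
  -- the nominal value at `v` of all edges except those to `Bk v`
  set b₀ : V → ℤ := fun v => ∑ u, (if Γ.Adj v u ∧ ¬ (v ∈ S ↔ u ∈ S) then 2 else 0) +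
    ∑ u, (if Γ.Adj v u ∧ (v ∈ S ↔ u ∈ S) ∧ rank v < rank u then 2 else 0) with hb₀
  have b₀_even : ∀ v, b₀ v % 2 = 0 := by
    intro v
    refine Int.emod_eq_zero_of_dvd (dvd_add ?_ ?_) <;>
    · refine Finset.dvd_sum fun u _ => ?_
      split_ifs <;> simp
  set cls : V → ℤ := fun v => if v ∈ S then 1 else 3 with hcls
  have cls_odd : ∀ v, cls v = 1 ∨ cls v = 3 := by
    intro v; simp only [hcls]; split_ifs <;> simp
  refine ⟨fun v => cls v - b₀ v, fun v => ?_, fun c hc => ?_⟩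
  · have := b₀_even v
    rcases cls_odd v with h | h <;> simp only [h] <;> omega
  have hb : ∀ v, (c v + b₀ v) % 4 = cls v := by
    intro v
    have := hc v
    rcases cls_odd v with h | h <;> simp only [h] at this ⊢ <;> omega
  obtain ⟨k, hk⟩ := exists_greedy rank Bk
    (fun v u hu => (Finset.mem_filter.1 hu).2.2.2) (fun v => c v + b₀ v)
  -- `Hi v` consists of the `u ∈ Bk v` for which the edge `uv` nominally counts 4 at `v`.
  have exHi : ∀ v, ∃ T ⊆ Bk v, #T = k v := fun v => Finset.exists_subset_card_eq (hk v).1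
  choose Hi hHi hHic using exHi
  have memHi : ∀ {u v}, u ∈ Hi v → Γ.Adj v u ∧ (v ∈ S ↔ u ∈ S) ∧ rank u < rank v :=
    fun {u v} h => (Finset.mem_filter.1 (hHi v h)).2
  -- For an edge inside a side of the cut, `ε v u` is the nominal minus the actual value at `v`.
  set ε : V → V → ℤ := fun v u => if u ∈ Hi v then 1 else if v ∈ Hi u then -1 else
    if rank u < rank v then -1 else if rank v < rank u then 1 else 0 with hε
  obtain ⟨φ, hφs, hφ1, hφ⟩ := exists_cut_adjustment Γ S hS ε
    (by
      intro x y
      simp only [hε]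
      by_cases h1 : x ∈ Hi y
      · have h2 : y ∉ Hi x := fun h2 => lt_asymm (memHi h1).2.2 (memHi h2).2.2
        simp [h1, h2]
      · by_cases h2 : y ∈ Hi x
        · simp [h1, h2]
        · simp only [h1, h2, if_false]
          rcases lt_trichotomy (rank x) (rank y) with h | h | h
          · simp [h, h.not_gt]
          · simp [h]
          · simp [h, h.not_gt])
    (by
      intro x y
      simp only [hε]
      split_ifs <;> simp)
  set h : V → V → ℤ := fun x y => if (x ∈ S ↔ y ∈ S) then
    (if x ∈ Hi y ∨ y ∈ Hi x then 3 else 1) else 2 + φ x y with hh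
  have hsymm : ∀ x y, h x y = h y x := by
    intro x y
    simp only [hh, hφs x y, iff_comm (a := x ∈ S), or_comm (a := x ∈ Hi y)]
  refine ⟨Sym2.lift ⟨h, hsymm⟩, ?_, ?_⟩
  · intro e
    induction e with
    | _ x y =>
      simp only [Sym2.lift_mk, hh]
      have := abs_le.1 (hφ1 x y)
      split_ifs <;> constructor <;> linarith
  have hw : ∀ v, wdeg Γ (Sym2.lift ⟨h, hsymm⟩) v = b₀ v + 4 * k v := by
    intro v
    have e : ∀ u, (if Γ.Adj v u then h v u else 0) =
        (if u ∈ Hi v then 4 else 0) +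
        (if Γ.Adj v u ∧ (v ∈ S ↔ u ∈ S) ∧ rank v < rank u then 2 else 0) +
        (if Γ.Adj v u ∧ ¬ (v ∈ S ↔ u ∈ S) then 2 else 0) +
        ((if Γ.Adj v u ∧ ¬ (v ∈ S ↔ u ∈ S) then φ v u else 0) -
          (if Γ.Adj v u ∧ (v ∈ S ↔ u ∈ S) then ε v u else 0)) := by
      intro u
      by_cases hvu : Γ.Adj v u
      · by_cases hc : (v ∈ S ↔ u ∈ S)
        · simp only [hvu, hc, hh, hε, if_true, true_and, not_true, if_false, add_zero, zero_sub]
          by_cases h1 : u ∈ Hi v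
          · have h3 := (memHi h1).2.2
            have h2 : v ∉ Hi u := fun h2 => lt_asymm h3 (memHi h2).2.2
            simp [h1, h2, h3.not_gt]
          · by_cases h2 : v ∈ Hi u
            · have h3 := (memHi h2).2.2
              simp [h1, h2, h3]
            · rcases lt_trichotomy (rank u) (rank v) with h | h | h
              · simp [h1, h2, h, h.not_gt]
              · exact absurd (rank_inj _ _ h).symm hvu.ne
              · simp [h1, h2, h, h.not_gt]
        · have h1 : u ∉ Hi v := fun h1 => hc (memHi h1).2.1
          simp only [hvu, hc, hh, h1, if_true, true_and, not_false_eq_true, if_false, false_and,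
            and_false]
          ring
      · have h1 : u ∉ Hi v := fun h1 => hvu (memHi h1).1
        simp [hvu, h1]
    have hsum := Finset.sum_congr (rfl : (univ : Finset V) = univ) fun u _ => e u
    simp only [Finset.sum_add_distrib, Finset.sum_sub_distrib] at hsum
    rw [hφ v, sub_self, add_zero] at hsum
    have h4 : ∑ u, (if u ∈ Hi v then (4 : ℤ) else 0) = 4 * k v := by
      rw [Finset.sum_ite_mem, Finset.univ_inter, Finset.sum_const, hHic]
      simp [mul_comm]
    simp only [wdeg, Sym2.lift_mk]
    rw [hsum, h4]
    simp only [hb₀]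
    ring
  refine ⟨fun v => ?_, fun u v huv => ?_⟩
  · have := hb v
    rw [hw]
    rcases cls_odd v with h | h <;> rw [h] at this <;> omega
  · rw [hw, hw]
    by_cases hc : (u ∈ S ↔ v ∈ S)
    · rcases lt_trichotomy (rank u) (rank v) with h | h | h
      · have := (hk v).2 u (Finset.mem_filter.2 ⟨mem_univ _, huv.symm, hc.symm, h⟩)
        intro he; apply this; linarith
      · exact absurd (rank_inj _ _ h) huv.ne
      · have := (hk u).2 v (Finset.mem_filter.2 ⟨mem_univ _, huv, hc, h⟩)
        intro he; apply this; linarith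
    · have h1 := hb u
      have h2 := hb v
      have h3 : cls u ≠ cls v := by
        simp only [hcls]
        by_cases h4 : u ∈ S <;> by_cases h5 : v ∈ S <;> simp [h4, h5] at hc ⊢
      omega

end Residues

/-! ### Parity labellings -/

section Parity

variable {V : Type*}

/-- The boundary modulo 2 of an edge labelling: the parity of the labels around a vertex. -/
noncomputable def bdry [Fintype V] (j : Sym2 V → ZMod 2) (v : V) : ZMod 2 := ∑ u, j s(v, u)

theorem ZMod.two_cases (a : ZMod 2) : a = 0 ∨ a = 1 := by
  revert a; decide

theorem cast_zmod_two_eq_one_iff (a : ℤ) : (a : ZMod 2) = 1 ↔ a % 2 = 1 := by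
  rw [← Int.cast_one, ZMod.intCast_eq_intCast_iff]
  exact Iff.rfl

theorem cast_zmod_two_eq_zero_iff (a : ℤ) : (a : ZMod 2) = 0 ↔ a % 2 = 0 := by
  rw [← Int.cast_zero, ZMod.intCast_eq_intCast_iff]
  exact Iff.rfl

/-- Parities prescribed on the edges not inside `A`, odd in total at each vertex of `A`, are
realised by weights from `{1, 2, 3}` for which all vertices of `A` have odd weighted degree and
adjacent vertices of `A` are distinguished. Each vertex of `A` has an edge of odd weight leaving
`A`; choosing between 1 and 3 there gives the residue modulo 4 that
`exists_odd_proper_weighting` asks for. -/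
theorem exists_weighting_of_parity [Fintype V] (G : SimpleGraph V) (A : Finset V)
    (j : Sym2 V → ZMod 2) (hj : ∀ x y, ¬ G.Adj x y → j s(x, y) = 0)
    (hA : ∀ x ∈ A, ∀ y ∈ A, j s(x, y) = 0) (hodd : ∀ v ∈ A, bdry j v = 1) :
    ∃ ω : Sym2 V → ℤ, (∀ e, 1 ≤ ω e ∧ ω e ≤ 3) ∧
      (∀ x y, G.Adj x y → y ∉ A → (ω s(x, y) : ZMod 2) = j s(x, y)) ∧
      (∀ v ∈ A, wdeg G ω v % 2 = 1) ∧
      ∀ u ∈ A, ∀ v ∈ A, G.Adj u v → wdeg G ω u ≠ wdeg G ω v := by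
  let Γ : SimpleGraph V :=
    { Adj := fun x y => G.Adj x y ∧ x ∈ A ∧ y ∈ A
      symm := ⟨fun x y h => ⟨h.1.symm, h.2.2, h.2.1⟩⟩
      loopless := ⟨fun x h => h.1.ne rfl⟩ }
  have hΓ : ∀ x y, Γ.Adj x y ↔ G.Adj x y ∧ x ∈ A ∧ y ∈ A := fun _ _ => Iff.rfl
  obtain ⟨τ, hτ, hmain⟩ := exists_odd_proper_weighting Γ
  have hα : ∀ v, ∃ u, v ∈ A → j s(v, u) ≠ 0 := by
    intro v
    by_cases hv : v ∈ A
    · obtain ⟨u, -, hu⟩ := Finset.exists_ne_zero_of_sum_ne_zero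
        (s := univ) (f := fun u => j s(v, u)) (by
          have := hodd v hv
          rw [bdry] at this
          rw [this]; decide)
      exact ⟨u, fun _ => hu⟩
    · exact ⟨v, fun h => absurd h hv⟩
  choose α hα using hα
  have hαA : ∀ v ∈ A, α v ∉ A := fun v hv h => hα v hv (hA v hv _ h)
  have hαadj : ∀ v ∈ A, G.Adj v (α v) := fun v hv => by
    by_contra h; exact hα v hv (hj _ _ h)
  set c₀ : V → ℤ := fun v => ∑ u, if G.Adj v u ∧ u ∉ A then (if j s(v, u) = 0 then 2 else 1) else 0
    with hc₀
  have hc₀odd : ∀ v ∈ A, c₀ v % 2 = 1 := by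
    intro v hv
    rw [← cast_zmod_two_eq_one_iff, ← hodd v hv, hc₀, bdry, Int.cast_sum]
    refine Finset.sum_congr rfl fun u _ => ?_
    by_cases h1 : G.Adj v u
    · by_cases h2 : u ∈ A
      · simp [h2, hA v hv u h2]
      · rcases ZMod.two_cases (j s(v, u)) with h3 | h3
        · simp only [h1, h2, h3, not_false_eq_true, and_self, if_true]; decide
        · simp [h1, h2, h3]
    · simp [h1, hj _ _ h1]
  -- `flag v` says that the designated odd edge `s(v, α v)` has to get weight 3 instead of 1.
  obtain ⟨flag, hflag⟩ : ∃ flag : V → Prop, ∀ v, flag v ↔ c₀ v % 4 ≠ τ v % 4 :=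
    ⟨_, fun _ => Iff.rfl⟩
  set ω₀ : Sym2 V → ℤ := fun e => if j e = 0 then 2 else
    if ∃ q ∈ A, flag q ∧ e = s(q, α q) then 3 else 1 with hω₀
  have hω₀1 : ∀ e, 1 ≤ ω₀ e ∧ ω₀ e ≤ 3 := by
    intro e; simp only [hω₀]; split_ifs <;> constructor <;> norm_num
  have hω₀p : ∀ e, (ω₀ e : ZMod 2) = j e := by
    intro e
    rcases ZMod.two_cases (j e) with h3 | h3
    · simp only [hω₀, h3, if_true]; decide
    · simp only [hω₀, h3, one_ne_zero, if_false]
      split_ifs <;> decide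
  set c : V → ℤ := fun v => if v ∈ A then ∑ u, (if G.Adj v u ∧ u ∉ A then ω₀ s(v, u) else 0)
    else τ v with hc
  have hcA : ∀ v ∈ A, c v = c₀ v + if flag v then 2 else 0 := by
    intro v hv
    have hsing : (if flag v then (2 : ℤ) else 0) =
        ∑ u, if u = α v then (if flag v then 2 else 0) else 0 := by simp
    simp only [hc, hv, if_true]
    rw [hsing, hc₀, ← Finset.sum_add_distrib]
    refine Finset.sum_congr rfl fun u _ => ?_
    by_cases h1 : G.Adj v u ∧ u ∉ A
    · have hiff : (∃ q ∈ A, flag q ∧ s(v, u) = s(q, α q)) ↔ flag v ∧ u = α v := by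
        constructor
        · rintro ⟨q, hq, hfq, he⟩
          rcases Sym2.eq_iff.1 he with ⟨rfl, rfl⟩ | ⟨-, rfl⟩
          · exact ⟨hfq, rfl⟩
          · exact absurd hq h1.2
        · rintro ⟨h2, rfl⟩; exact ⟨v, hv, h2, rfl⟩
      rw [if_pos h1, if_pos h1]
      simp only [hω₀, hiff]
      by_cases h2 : u = α v
      · subst h2
        have h3 := hα v hv
        by_cases h4 : flag v <;> simp [h3, h4]
      · simp [h2]
    · have h2 : u ≠ α v := by
        rintro rfl; exact h1 ⟨hαadj v hv, hαA v hv⟩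
      rw [if_neg h1, if_neg h1, if_neg h2, add_zero]
  have hcτ : ∀ v, c v % 4 = τ v % 4 := by
    intro v
    by_cases hv : v ∈ A
    · rw [hcA v hv]
      have h1 := hc₀odd v hv
      have h2 := hτ v
      by_cases h : c₀ v % 4 = τ v % 4
      · simp [hflag, h]
      · simp only [hflag, h, ne_eq, not_false_eq_true, if_true]; omega
    · simp [hc, hv]
  obtain ⟨ωA, hωA, hωodd, hωne⟩ := hmain c hcτ
  set ω : Sym2 V → ℤ := fun e => if e ∈ Γ.edgeSet then ωA e else ω₀ e with hω
  have hwd : ∀ v ∈ A, wdeg G ω v = c v + wdeg Γ ωA v := by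
    intro v hv
    simp only [wdeg, hc, hv, if_true, ← Finset.sum_add_distrib]
    refine Finset.sum_congr rfl fun u _ => ?_
    simp only [hω, SimpleGraph.mem_edgeSet, hΓ]
    by_cases h1 : G.Adj v u <;> by_cases h2 : u ∈ A <;> simp [h1, h2, hv]
  refine ⟨ω, fun e => ?_, fun x y hxy hy => ?_, fun v hv => ?_, fun u hu v hv huv => ?_⟩
  · simp only [hω]; split_ifs
    · exact hωA e
    · exact hω₀1 e
  · simp only [hω, SimpleGraph.mem_edgeSet, hΓ, hy, and_false, if_false, hω₀p]
  · rw [hwd v hv]; exact hωodd v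
  · rw [hwd u hu, hwd v hv]; exact hωne u v ⟨huv, hu, hv⟩

theorem wdeg_cast_eq_bdry [Fintype V] (G : SimpleGraph V) (A : Finset V)
    (j : Sym2 V → ZMod 2) (hj : ∀ x y, ¬ G.Adj x y → j s(x, y) = 0) (ω : Sym2 V → ℤ)
    (hω : ∀ x y, G.Adj x y → y ∉ A → (ω s(x, y) : ZMod 2) = j s(x, y)) (v : V) (hv : v ∉ A) :
    (wdeg G ω v : ZMod 2) = bdry j v := by
  rw [wdeg, bdry, Int.cast_sum]
  refine Finset.sum_congr rfl fun u _ => ?_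
  by_cases h : G.Adj v u
  · rw [if_pos h, Sym2.eq_swap, hω u v h.symm hv]
  · simp [h, hj _ _ h]

theorem bdry_add [Fintype V] (j k : Sym2 V → ZMod 2) (v : V) :
    bdry (j + k) v = bdry j v + bdry k v := by
  simp [bdry, Finset.sum_add_distrib]

theorem bdry_sum [Fintype V] {ι : Type*} (s : Finset ι) (j : ι → Sym2 V → ZMod 2) (v : V) :
    bdry (∑ i ∈ s, j i) v = ∑ i ∈ s, bdry (j i) v := by
  simp only [bdry, Finset.sum_apply]
  rw [Finset.sum_comm]

theorem bdry_single [Fintype V] {x y : V} (h : x ≠ y) (v : V) :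
    bdry (Pi.single s(x, y) 1) v = (if v = x then 1 else 0) + (if v = y then 1 else 0) := by
  simp only [bdry, Pi.single_apply, Sym2.eq_iff]
  by_cases h1 : v = x
  · subst h1
    simp [h]
  · by_cases h2 : v = y
    · subst h2
      simp [h1]
    · simp [h1, h2]

theorem sum_bdry [Fintype V] (j : Sym2 V → ZMod 2) (hj : ∀ x, j s(x, x) = 0) :
    ∑ v, bdry j v = 0 := by
  simp only [bdry]
  rw [← Fintype.sum_prod_type']
  refine Finset.sum_involution (fun p _ => p.swap) ?_ ?_ ?_ ?_
  · rintro ⟨x, y⟩ -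
    simp only [Prod.swap_prod_mk]
    rw [Sym2.eq_swap]; exact CharTwo.add_self_eq_zero _
  · rintro ⟨x, y⟩ - h he
    simp only [Prod.swap_prod_mk, Prod.mk.injEq] at he
    obtain ⟨rfl, -⟩ := he
    exact h (hj _)
  · simp
  · simp

theorem exists_path_labelling [Fintype V] (H : SimpleGraph V) {x y : V} (h : H.Reachable x y) :
    ∃ j : Sym2 V → ZMod 2, (∀ a b, ¬ H.Adj a b → j s(a, b) = 0) ∧
      ∀ v, bdry j v = (if v = x then 1 else 0) + (if v = y then 1 else 0) := by
  rw [SimpleGraph.reachable_iff_reflTransGen] at h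
  induction h with
  | refl => exact ⟨0, by simp, fun v => by simp [bdry, CharTwo.add_self_eq_zero]⟩
  | @tail b c _ hbc ih =>
    obtain ⟨j, hj, hb⟩ := ih
    refine ⟨j + Pi.single s(b, c) 1, fun a d had => ?_, fun v => ?_⟩
    · have : s(a, d) ≠ s(b, c) := by
        intro he
        rcases Sym2.eq_iff.1 he with ⟨rfl, rfl⟩ | ⟨rfl, rfl⟩
        · exact had hbc
        · exact had hbc.symm
      simp [hj a d had, this]
    · rw [bdry_add, hb, bdry_single hbc.ne]
      have := CharTwo.add_self_eq_zero (if v = b then (1 : ZMod 2) else 0)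
      linear_combination this

/-- In a connected graph, every even set of vertices is the set of vertices of odd degree of some
set of edges: add up paths from the root `ρ`. -/
theorem exists_bdry_eq [Fintype V] (H : SimpleGraph V) (ρ : V) (p : V → ZMod 2)
    (hp : ∀ x, p x ≠ 0 → H.Reachable ρ x) (h0 : ∑ x, p x = 0) :
    ∃ j : Sym2 V → ZMod 2, (∀ a b, ¬ H.Adj a b → j s(a, b) = 0) ∧ ∀ v, bdry j v = p v := by
  have ex : ∀ x, ∃ j : Sym2 V → ZMod 2, (∀ a b, ¬ H.Adj a b → j s(a, b) = 0) ∧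
      ∀ v, bdry j v = p x * ((if v = ρ then 1 else 0) + (if v = x then 1 else 0)) := by
    intro x
    rcases ZMod.two_cases (p x) with h | h
    · exact ⟨0, by simp, fun v => by simp [bdry, h]⟩
    · obtain ⟨j, h1, h2⟩ := exists_path_labelling H (hp x (by rw [h]; exact one_ne_zero))
      exact ⟨j, h1, fun v => by rw [h2, h, one_mul]⟩
  choose J hJ1 hJ2 using ex
  refine ⟨∑ x, J x, fun a b hab => ?_, fun v => ?_⟩
  · rw [Finset.sum_apply]
    exact Finset.sum_eq_zero fun x _ => hJ1 x a b hab
  · rw [bdry_sum]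
    simp only [hJ2, mul_add, Finset.sum_add_distrib, ← Finset.sum_mul, h0]
    simp

/-- The graph `H` with all edges at the vertices of `Z` removed. -/
def del (H : SimpleGraph V) (Z : Finset V) : SimpleGraph V where
  Adj x y := H.Adj x y ∧ x ∉ Z ∧ y ∉ Z
  symm := ⟨fun _ _ h => ⟨h.1.symm, h.2.2, h.2.1⟩⟩
  loopless := ⟨fun _ h => h.1.ne rfl⟩

/-- If `H` minus `Z` is connected, then a labelling `k` with the right parities on `Z` can be
corrected by labels on the edges of `H` that avoid `Z`, so as to have any prescribed parities of
even total. -/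
theorem exists_bdry_eq_extending [Fintype V] (H : SimpleGraph V) (Z : Finset V) (ρ : V)
    (hZ : ∀ x, x ∉ Z → (del H Z).Reachable ρ x) (k : Sym2 V → ZMod 2) (hk : ∀ x, k s(x, x) = 0)
    (p : V → ZMod 2) (h0 : ∑ x, p x = 0) (hkZ : ∀ z ∈ Z, bdry k z = p z) :
    ∃ j : Sym2 V → ZMod 2, (∀ v, bdry j v = p v) ∧
      (∀ x y, ¬ H.Adj x y → j s(x, y) = k s(x, y)) ∧ ∀ x y, x ∈ Z → j s(x, y) = k s(x, y) := by
  obtain ⟨j, h1, h2⟩ := exists_bdry_eq (del H Z) ρ (fun v => p v - bdry k v)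
    (fun x hx => hZ x fun hxZ => hx (by rw [hkZ x hxZ, sub_self]))
    (by rw [Finset.sum_sub_distrib, h0, sum_bdry k hk, sub_zero])
  refine ⟨k + j, fun v => by rw [bdry_add, h2]; ring, fun x y hxy => ?_, fun x y hx => ?_⟩
  · simp [h1 x y fun h => hxy h.1]
  · simp [h1 x y fun h => h.2.1 hx]

theorem reachable_del (H : SimpleGraph V) (Z : Finset V) (ρ : V) (d : V → ℕ)
    (h : ∀ x, x ∉ Z → x ≠ ρ → ∃ y, y ∉ Z ∧ H.Adj x y ∧ d y < d x) (x : V) (hx : x ∉ Z) :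
    (del H Z).Reachable ρ x := by
  induction hn : d x using Nat.strong_induction_on generalizing x with
  | _ n ih =>
    by_cases hxρ : x = ρ
    · subst hxρ; exact SimpleGraph.Reachable.refl _
    · obtain ⟨y, hy, hxy, hd⟩ := h x hx hxρ
      have hr := ih (d y) (hn ▸ hd) y hy rfl
      exact hr.trans (SimpleGraph.Adj.reachable (G := del H Z) ⟨hxy.symm, hy, hx⟩)

/-- For `n k` the number of `r ∈ M` with `e r = k`, a set of size `k` as required exists as soon as
`n k ≤ k` and `n (k - 1) ≤ #M - k`: it contains all `r` with `e r = k` and none with `e r = k - 1`.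
This holds for some `k`: if some `n k` with `0 ≤ k < #M`
vanishes, then `k` or `k + 1` will do, and otherwise all of them are 1 and `k = 1` will do. -/
theorem exists_subset_card_erase_ne (M : Finset V) (hM : 2 ≤ #M) (e : V → ℤ) :
    ∃ T ⊆ M, ∀ r ∈ M, (#(T.erase r) : ℤ) ≠ e r := by
  set n : ℤ → ℕ := fun k => #(M.filter fun r => e r = k) with hn
  have key : ∀ k : ℕ, n k ≤ k → n (k - 1) + k ≤ #M →
      ∃ T ⊆ M, ∀ r ∈ M, (#(T.erase r) : ℤ) ≠ e r := by
    intro k h1 h2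
    have hsub : M.filter (fun r => e r = k) ⊆ M \ M.filter (fun r => e r = k - 1) := by
      intro r hr
      simp only [mem_filter, mem_sdiff, not_and] at hr ⊢
      exact ⟨hr.1, fun _ h => by rw [hr.2] at h; omega⟩
    obtain ⟨T, hT1, hT2, hTc⟩ := Finset.exists_subsuperset_card_eq hsub h1 (by
      rw [Finset.card_sdiff_of_subset (Finset.filter_subset _ _)]
      change k ≤ #M - n (k - 1)
      omega)
    refine ⟨T, hT2.trans Finset.sdiff_subset, fun r hr => ?_⟩
    by_cases hrT : r ∈ T
    · have h3 : e r ≠ k - 1 := fun h =>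
        (Finset.mem_sdiff.1 (hT2 hrT)).2 (Finset.mem_filter.2 ⟨hr, h⟩)
      have h4 := Finset.card_erase_add_one hrT
      rw [hTc] at h4
      omega
    · have h3 : e r ≠ k := fun h => hrT (hT1 (Finset.mem_filter.2 ⟨hr, h⟩))
      rw [Finset.erase_eq_of_notMem hrT, hTc]
      exact h3.symm
  have hle : ∀ k, n k ≤ #M := fun k => Finset.card_filter_le _ _
  have hle2 : ∀ k l, k ≠ l → n k + n l ≤ #M := by
    intro k l hkl
    simp only [hn]
    rw [← Finset.card_union_of_disjoint]
    · exact Finset.card_le_card (Finset.union_subset (Finset.filter_subset _ _)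
        (Finset.filter_subset _ _))
    · exact Finset.disjoint_filter.2 fun r _ h1 h2 => hkl (h1.symm.trans h2)
  by_cases hz : ∃ i : ℕ, i < #M ∧ n i = 0
  · obtain ⟨i, hi, hni⟩ := hz
    by_cases h1 : n ((i : ℤ) - 1) + i ≤ #M
    · exact key i (by omega) h1
    · refine key (i + 1) ?_ ?_
      · have h2 := hle2 ((i : ℤ) - 1) (i + 1) (by omega)
        push_cast
        omega
      · have : ((i + 1 : ℕ) : ℤ) - 1 = i := by push_cast; ring
        rw [this, hni]; omega
  · push Not at hz
    have hsum : ∑ i ∈ Finset.range #M, n i ≤ #M := by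
      simp only [hn, Finset.card_filter]
      rw [Finset.sum_comm]
      refine (Finset.sum_le_card_nsmul _ _ 1 fun r _ => ?_).trans (by simp)
      rw [← Finset.card_filter]
      refine Finset.card_le_one.2 fun a ha b hb => ?_
      have := (Finset.mem_filter.1 ha).2.symm.trans (Finset.mem_filter.1 hb).2
      exact_mod_cast this
    have hone : ∀ i ∈ Finset.range #M, n i = 1 := by
      have h1 : ∀ i ∈ Finset.range #M, 1 ≤ n i := fun i hi =>
        Nat.one_le_iff_ne_zero.2 (hz i (Finset.mem_range.1 hi))
      have h2 : ∑ i ∈ Finset.range #M, 1 = ∑ i ∈ Finset.range #M, n i :=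
        le_antisymm (Finset.sum_le_sum h1) (by simpa using hsum)
      exact fun i hi => ((Finset.sum_eq_sum_iff_of_le h1).1 h2 i hi).symm
    have h0 := hone 0 (Finset.mem_range.2 (by omega))
    have h1 := hone 1 (Finset.mem_range.2 (by omega))
    refine key 1 h1.le ?_
    simp only [Nat.cast_one, sub_self]
    rw [Nat.cast_zero] at h0
    omega

end Parity

/-! ### Weightings with a single exceptional vertex -/

section Exceptional

variable {V : Type*}

/-- The weights `ω` lie in `{1, 2, 3}` and distinguish adjacent vertices by weighted degree. -/
def IsSolution [Fintype V] (G : SimpleGraph V) (ω : Sym2 V → ℤ) : Prop :=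
  (∀ e, 1 ≤ ω e ∧ ω e ≤ 3) ∧ ∀ u v, G.Adj u v → wdeg G ω u ≠ wdeg G ω v

theorem wdeg_congr [Fintype V] {G : SimpleGraph V} {ω ω' : Sym2 V → ℤ} {v : V}
    (h : ∀ u, G.Adj v u → ω s(v, u) = ω' s(v, u)) : wdeg G ω v = wdeg G ω' v := by
  refine Finset.sum_congr rfl fun u _ => ?_
  by_cases hu : G.Adj v u
  · rw [if_pos hu, if_pos hu, h u hu]
  · rw [if_neg hu, if_neg hu]

theorem wdeg_update_left [Fintype V] {G : SimpleGraph V} (ω : Sym2 V → ℤ) {x y : V}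
    (h : G.Adj x y) (k : ℤ) :
    wdeg G (Function.update ω s(x, y) k) x = wdeg G ω x - ω s(x, y) + k := by
  have : wdeg G (Function.update ω s(x, y) k) x - wdeg G ω x =
      ∑ u, if u = y then k - ω s(x, y) else 0 := by
    rw [wdeg, wdeg, ← Finset.sum_sub_distrib]
    refine Finset.sum_congr rfl fun u _ => ?_
    by_cases hu : u = y
    · subst hu; simp [h]
    · have : s(x, u) ≠ s(x, y) := fun he => hu (Sym2.congr_right.1 he)
      simp [hu, this]
  rw [Finset.sum_ite_eq' univ y, if_pos (mem_univ _)] at this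
  linarith

theorem wdeg_update_right [Fintype V] {G : SimpleGraph V} (ω : Sym2 V → ℤ) {x y : V}
    (h : G.Adj x y) (k : ℤ) :
    wdeg G (Function.update ω s(x, y) k) y = wdeg G ω y - ω s(x, y) + k := by
  rw [Sym2.eq_swap]; exact wdeg_update_left ω h.symm k

theorem wdeg_update_of_ne [Fintype V] {G : SimpleGraph V} (ω : Sym2 V → ℤ) {x y z : V}
    (hx : z ≠ x) (hy : z ≠ y) (k : ℤ) :
    wdeg G (Function.update ω s(x, y) k) z = wdeg G ω z := by
  refine wdeg_congr fun u _ => Function.update_of_ne (fun he => ?_) _ _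
  rcases Sym2.eq_iff.1 he with ⟨h, -⟩ | ⟨h, -⟩
  · exact hx h
  · exact hy h

theorem update_mem_range {ω : Sym2 V → ℤ} (h : ∀ e, 1 ≤ ω e ∧ ω e ≤ 3) {k : ℤ} (h1 : 1 ≤ k)
    (h3 : k ≤ 3) (e₀ e : Sym2 V) :
    1 ≤ Function.update ω e₀ k e ∧ Function.update ω e₀ k e ≤ 3 := by
  by_cases he : e = e₀
  · subst he; simp [h1, h3]
  · simpa [he] using h e

theorem eq_two_of_cast_eq_zero {a : ℤ} (h : 1 ≤ a ∧ a ≤ 3) (h0 : (a : ZMod 2) = 0) : a = 2 := by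
  rw [cast_zmod_two_eq_zero_iff] at h0; omega

theorem eq_one_or_three_of_cast_eq_one {a : ℤ} (h : 1 ≤ a ∧ a ≤ 3) (h0 : (a : ZMod 2) = 1) :
    a = 1 ∨ a = 3 := by
  rw [cast_zmod_two_eq_one_iff] at h0; omega

/-- An independent set `R` with even vertices, one further even vertex `v`, and all other vertices
odd: only the edges between odd vertices and those between `v` and `R` need attention. -/
theorem isSolution_of_parity [Fintype V] {G : SimpleGraph V} {R : Finset V} {v : V}
    {ω : Sym2 V → ℤ} (hR : ∀ x ∈ R, ∀ y ∈ R, ¬ G.Adj x y) (hω : ∀ e, 1 ≤ ω e ∧ ω e ≤ 3)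
    (hodd : ∀ q ∈ (insert v R)ᶜ, wdeg G ω q % 2 = 1)
    (heven : ∀ q, q ∉ (insert v R)ᶜ → wdeg G ω q % 2 = 0)
    (hA : ∀ x ∈ (insert v R)ᶜ, ∀ y ∈ (insert v R)ᶜ, G.Adj x y → wdeg G ω x ≠ wdeg G ω y)
    (hv : ∀ r ∈ R, G.Adj v r → wdeg G ω v ≠ wdeg G ω r) : IsSolution G ω := by
  refine ⟨hω, fun x y hxy => ?_⟩
  by_cases hx : x ∈ (insert v R)ᶜ
  · by_cases hy : y ∈ (insert v R)ᶜ
    · exact hA x hx y hy hxy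
    · have h1 := hodd x hx
      have h2 := heven y hy
      omega
  · by_cases hy : y ∈ (insert v R)ᶜ
    · have h1 := hodd y hy
      have h2 := heven x hx
      omega
    · rw [mem_compl, not_not, mem_insert] at hx hy
      rcases hx with rfl | hx
      · rcases hy with rfl | hy
        · exact absurd rfl hxy.ne
        · exact hv y hy hxy
      · rcases hy with rfl | hy
        · exact (hv x hx hxy.symm).symm
        · exact absurd hxy (hR x hx y hy)

/-- An even vertex `v` all of whose at least two edges to `R` are odd: the weights 1 and 3 can be
chosen freely on these edges, and `exists_subset_card_erase_ne` chooses them. -/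
theorem exists_solution_of_all_odd [Fintype V] {G : SimpleGraph V} {R : Finset V} {v : V}
    (hR : ∀ x ∈ R, ∀ y ∈ R, ¬ G.Adj x y)
    (hm : 2 ≤ #(R.filter fun r => G.Adj v r)) (j : Sym2 V → ZMod 2)
    (hj : ∀ x y, ¬ G.Adj x y → j s(x, y) = 0)
    (hjA : ∀ x ∈ (insert v R)ᶜ, ∀ y ∈ (insert v R)ᶜ, j s(x, y) = 0)
    (hodd : ∀ q ∈ (insert v R)ᶜ, bdry j q = 1) (heven : ∀ q, q ∉ (insert v R)ᶜ → bdry j q = 0)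
    (hv1 : ∀ r ∈ R, G.Adj v r → j s(v, r) = 1) : ∃ ω, IsSolution G ω := by
  obtain ⟨ω, hω, hωj, hωodd, hωne⟩ := exists_weighting_of_parity G _ j hj hjA hodd
  set M := R.filter fun r => G.Adj v r with hM
  have memM : ∀ r, r ∈ M ↔ r ∈ R ∧ G.Adj v r := fun r => Finset.mem_filter
  set Y : ℤ := ∑ u, (if G.Adj v u ∧ u ∉ M then ω s(v, u) else 0) with hY
  obtain ⟨T, hTM, hT⟩ := exists_subset_card_erase_ne M hm
    (fun r => (wdeg G ω r - ω s(r, v) + 1 - Y - #M) / 2)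
  set ω' : Sym2 V → ℤ := fun e => if ∃ r ∈ M, e = s(v, r) then
    (if ∃ r ∈ T, e = s(v, r) then 3 else 1) else ω e with hω'
  have hrange : ∀ e, 1 ≤ ω' e ∧ ω' e ≤ 3 := by
    intro e
    simp only [hω']
    split_ifs
    · norm_num
    · norm_num
    · exact hω e
  have hvr : ∀ u, ω' s(v, u) = if u ∈ M then (if u ∈ T then 3 else 1) else ω s(v, u) := by
    intro u
    have h1 : ∀ X : Finset V, (∃ r ∈ X, s(v, u) = s(v, r)) ↔ u ∈ X := fun X =>
      ⟨fun ⟨r, hr, he⟩ => Sym2.congr_right.1 he ▸ hr, fun h => ⟨u, h, rfl⟩⟩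
    simp only [hω', h1]
  have hne : ∀ x y, x ≠ v → y ≠ v → ω' s(x, y) = ω s(x, y) := by
    intro x y hx hy
    have : ¬ ∃ r ∈ M, s(x, y) = s(v, r) := by
      rintro ⟨r, -, he⟩
      rcases Sym2.eq_iff.1 he with ⟨h, -⟩ | ⟨-, h⟩
      · exact hx h
      · exact hy h
    simp only [hω', if_neg this]
  have hpar : ∀ x y, G.Adj x y → y ∉ (insert v R)ᶜ → (ω' s(x, y) : ZMod 2) = j s(x, y) := by
    have hvpar : ∀ u, G.Adj v u → (ω' s(v, u) : ZMod 2) = j s(v, u) := by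
      intro u hu
      rw [hvr]
      by_cases huM : u ∈ M
      · rw [hv1 u ((memM u).1 huM).1 hu]
        simp only [huM, if_true]
        split_ifs <;> decide
      · simp only [huM, if_false]
        rw [Sym2.eq_swap]
        exact hωj u v hu.symm (by simp)
    intro x y hxy hy
    by_cases hxv : x = v
    · subst hxv; exact hvpar y hxy
    by_cases hyv : y = v
    · subst hyv; rw [Sym2.eq_swap]; exact hvpar x hxy.symm
    rw [hne x y hxv hyv]; exact hωj x y hxy hy
  have hunch : ∀ q ∈ (insert v R)ᶜ, wdeg G ω' q = wdeg G ω q := by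
    intro q hq
    refine wdeg_congr fun u _ => ?_
    simp only [mem_compl, mem_insert, not_or] at hq
    by_cases huv : u = v
    · subst huv
      rw [Sym2.eq_swap, hvr, if_neg fun h => hq.2 ((memM q).1 h).1]
    · exact hne q u hq.1 huv
  have hwv : wdeg G ω' v = Y + #M + 2 * #T := by
    have e : ∀ u, (if G.Adj v u then ω' s(v, u) else 0) =
        (if G.Adj v u ∧ u ∉ M then ω s(v, u) else 0) + (if u ∈ M then 1 else 0) +
          (if u ∈ T then 2 else 0) := by
      intro u
      rw [hvr]
      by_cases h1 : u ∈ M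
      · have h2 := ((memM u).1 h1).2
        by_cases h3 : u ∈ T <;> simp [h1, h2, h3]
      · have h3 : u ∉ T := fun h => h1 (hTM h)
        by_cases h2 : G.Adj v u <;> simp [h1, h2, h3]
    rw [wdeg, Finset.sum_congr rfl fun u _ => e u, Finset.sum_add_distrib,
      Finset.sum_add_distrib, Finset.sum_ite_mem, Finset.sum_ite_mem]
    simp [hY, mul_comm]
  have hwr : ∀ r ∈ M, wdeg G ω' r = wdeg G ω r - ω s(r, v) + 1 + if r ∈ T then 2 else 0 := by
    intro r hr
    have hrv : G.Adj r v := ((memM r).1 hr).2.symm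
    have : wdeg G ω' r = wdeg G (Function.update ω s(r, v) (ω' s(v, r))) r := by
      refine wdeg_congr fun u hu => ?_
      by_cases huv : u = v
      · subst huv
        rw [Function.update_self, Sym2.eq_swap]
      · have h1 : s(r, u) ≠ s(r, v) := fun he => huv (Sym2.congr_right.1 he)
        rw [Function.update_of_ne h1, hne r u hrv.ne huv]
    rw [this, wdeg_update_left ω hrv, hvr, if_pos hr]
    split_ifs <;> ring
  refine ⟨ω', isSolution_of_parity (v := v) hR hrange (fun q hq => ?_) (fun q hq => ?_)
    (fun x hx y hy hxy => ?_) fun r hr hadj => ?_⟩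
  · rw [hunch q hq]; exact hωodd q hq
  · rw [← cast_zmod_two_eq_zero_iff, wdeg_cast_eq_bdry G _ j hj ω' hpar q hq, heven q hq]
  · rw [hunch x hx, hunch y hy]; exact hωne x hx y hy hxy
  · have hrM := (memM r).2 ⟨hr, hadj⟩
    have h1 := hT r hrM
    rw [hwv, hwr r hrM]
    by_cases hrT : r ∈ T
    · have h2 := Finset.card_erase_add_one hrT
      simp only [hrT, if_true]
      omega
    · rw [Finset.erase_eq_of_notMem hrT] at h1
      simp only [hrT, if_false]
      omega

/-- An even vertex `v` with a single neighbour `r` in `R` and a triangle `v`, `r`, `b`: weight can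
be moved between the edges `vb` and `rb` without changing the weighted degree of `b`, which
settles a conflict between `v` and `r`. -/
theorem exists_solution_of_triangle [Fintype V] {G : SimpleGraph V} {R : Finset V} {v r b : V}
    (hR : ∀ x ∈ R, ∀ y ∈ R, ¬ G.Adj x y) (hr : r ∈ R) (hvr : G.Adj v r)
    (huniq : ∀ x ∈ R, G.Adj v x → x = r) (hvb : G.Adj v b) (hbr : G.Adj b r)
    (j : Sym2 V → ZMod 2) (hj : ∀ x y, ¬ G.Adj x y → j s(x, y) = 0)
    (hjA : ∀ x ∈ (insert v R)ᶜ, ∀ y ∈ (insert v R)ᶜ, j s(x, y) = 0)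
    (hodd : ∀ q ∈ (insert v R)ᶜ, bdry j q = 1) (heven : ∀ q, q ∉ (insert v R)ᶜ → bdry j q = 0)
    (hv0 : ∀ x, j s(v, x) = 0) : ∃ ω, IsSolution G ω := by
  obtain ⟨ω, hω, hωj, hωodd, hωne⟩ := exists_weighting_of_parity G _ j hj hjA hodd
  have hωeven : ∀ q, q ∉ (insert v R)ᶜ → wdeg G ω q % 2 = 0 := fun q hq => by
    rw [← cast_zmod_two_eq_zero_iff, wdeg_cast_eq_bdry G _ j hj ω hωj q hq, heven q hq]
  by_cases hc : wdeg G ω v = wdeg G ω r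
  swap
  · exact ⟨ω, isSolution_of_parity hR hω hωodd hωeven hωne fun x hx hvx => by
      rwa [huniq x hx hvx]⟩
  have htwo : ∀ x, G.Adj v x → ω s(v, x) = 2 := fun x hx =>
    eq_two_of_cast_eq_zero (hω _) (by
      rw [Sym2.eq_swap, hωj x v hx.symm (by simp), Sym2.eq_swap, hv0])
  obtain ⟨y, t, hy, ht, hsum, hd⟩ : ∃ y t : ℤ, (1 ≤ y ∧ y ≤ 3) ∧ (1 ≤ t ∧ t ≤ 3) ∧
      y + t = 2 + ω s(b, r) ∧ (y = 1 ∨ y = 3) := by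
    have h := hω s(b, r)
    have : ω s(b, r) = 1 ∨ ω s(b, r) = 2 ∨ ω s(b, r) = 3 := by omega
    rcases this with h | h | h
    · exact ⟨1, 2, by norm_num, by norm_num, by omega, by norm_num⟩
    · exact ⟨1, 3, by norm_num, by norm_num, by omega, by norm_num⟩
    · exact ⟨3, 2, by norm_num, by norm_num, by omega, by norm_num⟩
  have hrb : r ≠ b := hbr.ne.symm
  set ω₁ := Function.update ω s(v, r) 1 with hω₁
  set ω₂ := Function.update ω₁ s(v, b) y with hω₂
  set ω₃ := Function.update ω₂ s(b, r) t with hω₃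
  have h1b : ω₁ s(v, b) = 2 := by
    rw [hω₁, Function.update_of_ne, htwo b hvb]
    exact fun he => hrb.symm (Sym2.congr_right.1 he)
  have h2r : ω₂ s(b, r) = ω s(b, r) := by
    rw [hω₂, Function.update_of_ne, hω₁, Function.update_of_ne]
    · intro he
      rcases Sym2.eq_iff.1 he with ⟨h, -⟩ | ⟨h, -⟩
      · exact hvb.ne h.symm
      · exact hrb h.symm
    · intro he
      rcases Sym2.eq_iff.1 he with ⟨h, -⟩ | ⟨-, h⟩
      · exact hvb.ne h.symm
      · exact hvr.ne h.symm
  have hwv : wdeg G ω₃ v = wdeg G ω v - 3 + y := by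
    rw [hω₃, wdeg_update_of_ne _ hvb.ne hvr.ne, hω₂, wdeg_update_left _ hvb, h1b, hω₁,
      wdeg_update_left _ hvr, htwo r hvr]
    ring
  have hwr : wdeg G ω₃ r = wdeg G ω r - 1 - ω s(b, r) + t := by
    rw [hω₃, wdeg_update_right _ hbr, h2r, hω₂, wdeg_update_of_ne _ hvr.ne.symm hrb, hω₁,
      wdeg_update_right _ hvr, htwo r hvr]
    ring
  have hwb : wdeg G ω₃ b = wdeg G ω b := by
    rw [hω₃, wdeg_update_left _ hbr, h2r, hω₂, wdeg_update_right _ hvb, h1b, hω₁,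
      wdeg_update_of_ne _ hvb.ne.symm hrb.symm]
    linarith
  have hw : ∀ q, q ≠ v → q ≠ r → wdeg G ω₃ q = wdeg G ω q := by
    intro q h1 h2
    by_cases h3 : q = b
    · rw [h3, hwb]
    · rw [hω₃, wdeg_update_of_ne _ h3 h2, hω₂, wdeg_update_of_ne _ h1 h3, hω₁,
        wdeg_update_of_ne _ h1 h2]
  have hwA : ∀ q ∈ (insert v R)ᶜ, wdeg G ω₃ q = wdeg G ω q := by
    intro q hq
    simp only [mem_compl, mem_insert, not_or] at hq
    exact hw q hq.1 fun h => hq.2 (h ▸ hr)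
  refine ⟨ω₃, isSolution_of_parity (v := v) hR ?_ (fun q hq => ?_) (fun q hq => ?_)
    (fun x hx y hy hxy => ?_) fun x hx hvx => ?_⟩
  · exact update_mem_range (update_mem_range (update_mem_range hω le_rfl (by norm_num) _)
      hy.1 hy.2 _) ht.1 ht.2 _
  · rw [hwA q hq]; exact hωodd q hq
  · have h := hωeven q hq
    by_cases h1 : q = v
    · subst h1; rw [hwv]; omega
    · by_cases h2 : q = r
      · subst h2; rw [hwr]; omega
      · rwa [hw q h1 h2]
  · rw [hwA x hx, hwA y hy]; exact hωne x hx y hy hxy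
  · rw [huniq x hx hvx, hwv, hwr, hc]
    omega

/-- An even vertex `u` with a single neighbour `r` in `R`, and a further neighbour `a` of `r` whose
neighbours are all in `R`: the edge `ar` of odd weight may switch between 1 and 3. -/
theorem exists_solution_of_helper [Fintype V] {G : SimpleGraph V} {R : Finset V} {u r a : V}
    (hR : ∀ x ∈ R, ∀ y ∈ R, ¬ G.Adj x y) (huR : u ∉ R) (hr : r ∈ R)
    (huniq : ∀ x ∈ R, G.Adj u x → x = r) (ha : a ∉ R) (hau : a ≠ u) (har : G.Adj a r)
    (haN : ∀ x, G.Adj a x → x ∈ R)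
    (j : Sym2 V → ZMod 2) (hj : ∀ x y, ¬ G.Adj x y → j s(x, y) = 0)
    (hjA : ∀ x ∈ (insert u R)ᶜ, ∀ y ∈ (insert u R)ᶜ, j s(x, y) = 0)
    (hodd : ∀ q ∈ (insert u R)ᶜ, bdry j q = 1) (heven : ∀ q, q ∉ (insert u R)ᶜ → bdry j q = 0)
    (hja : j s(a, r) = 1) : ∃ ω, IsSolution G ω := by
  obtain ⟨ω, hω, hωj, hωodd, hωne⟩ := exists_weighting_of_parity G _ j hj hjA hodd
  have hωeven : ∀ q, q ∉ (insert u R)ᶜ → wdeg G ω q % 2 = 0 := fun q hq => by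
    rw [← cast_zmod_two_eq_zero_iff, wdeg_cast_eq_bdry G _ j hj ω hωj q hq, heven q hq]
  by_cases hc : wdeg G ω u = wdeg G ω r
  swap
  · exact ⟨ω, isSolution_of_parity hR hω hωodd hωeven hωne fun x hx hvx => by
      rwa [huniq x hx hvx]⟩
  have h13 : ω s(a, r) = 1 ∨ ω s(a, r) = 3 := eq_one_or_three_of_cast_eq_one (hω _) (by
    rw [hωj a r har (by simp [hr]), hja])
  have hru : r ≠ u := fun h => huR (h ▸ hr)
  have hwr := wdeg_update_right ω har (4 - ω s(a, r))
  have hwa := wdeg_update_left ω har (4 - ω s(a, r))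
  have hwq : ∀ q, q ≠ a → q ≠ r → wdeg G (Function.update ω s(a, r) (4 - ω s(a, r))) q =
      wdeg G ω q := fun q h1 h2 => wdeg_update_of_ne ω h1 h2 _
  refine ⟨Function.update ω s(a, r) (4 - ω s(a, r)), isSolution_of_parity (v := u) hR
    (update_mem_range hω (by omega) (by omega) _) (fun q hq => ?_) (fun q hq => ?_)
    (fun x hx y hy hxy => ?_) fun x hx hux => ?_⟩
  · have h := hωodd q hq
    simp only [mem_compl, mem_insert, not_or] at hq
    by_cases hqa : q = a
    · subst hqa; omega
    · rwa [hwq q hqa fun h => hq.2 (h ▸ hr)]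
  · have h := hωeven q hq
    by_cases hqr : q = r
    · subst hqr; omega
    · rwa [hwq q _ hqr]
      rintro rfl
      simp [hau, ha] at hq
  · have h := hωne x hx y hy hxy
    simp only [mem_compl, mem_insert, not_or] at hx hy
    rwa [hwq x (fun h => hy.2 (haN y (h ▸ hxy))) fun h => hx.2 (h ▸ hr),
      hwq y (fun h => hx.2 (haN x (h ▸ hxy.symm))) fun h => hy.2 (h ▸ hr)]
  · rw [huniq x hx hux, hwq u hau.symm hru.symm]
    omega

/-- A vertex `v` whose neighbours are all in `R`, among them `r` and `s`: with `r` moved to the odd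
side and `v` odd, the only possible conflict is between `v` and `r`, and the edge `vs` of odd weight
may switch between 1 and 3. -/
theorem exists_solution_of_exchange [Fintype V] {G : SimpleGraph V} {R : Finset V} {v r s : V}
    (hR : ∀ x ∈ R, ∀ y ∈ R, ¬ G.Adj x y) (hvR : v ∉ R) (hs : s ∈ R) (hrs : r ≠ s)
    (hvr : G.Adj v r) (hvs : G.Adj v s) (hvN : ∀ x, G.Adj v x → x ∈ R)
    (j : Sym2 V → ZMod 2) (hj : ∀ x y, ¬ G.Adj x y → j s(x, y) = 0)
    (hjA : ∀ x ∈ (insert v (R.erase r))ᶜ, ∀ y ∈ (insert v (R.erase r))ᶜ, j s(x, y) = 0)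
    (hodd : ∀ q ∈ (insert v (R.erase r))ᶜ, bdry j q = 1) (hv : bdry j v = 1)
    (heven : ∀ q ∈ R.erase r, bdry j q = 0)
    (hjs : j s(v, s) = 1) : ∃ ω, IsSolution G ω := by
  obtain ⟨ω, hω, hωj, hωodd, hωne⟩ := exists_weighting_of_parity G _ j hj hjA hodd
  have hωeven : ∀ q ∈ R.erase r, wdeg G ω q % 2 = 0 := fun q hq => by
    rw [← cast_zmod_two_eq_zero_iff, wdeg_cast_eq_bdry G _ j hj ω hωj q (by
      simp only [mem_compl, mem_insert, hq, or_true, not_true, not_false_eq_true]), heven q hq]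
  have hωv : wdeg G ω v % 2 = 1 := by
    rw [← cast_zmod_two_eq_one_iff, wdeg_cast_eq_bdry G _ j hj ω hωj v (by simp), hv]
  -- it suffices to have the parities, proper colours on the odd side, and no conflict of `v`, `r`
  have fin : ∀ ω' : Sym2 V → ℤ, (∀ e, 1 ≤ ω' e ∧ ω' e ≤ 3) →
      (∀ q, q ≠ v → q ≠ s → wdeg G ω' q = wdeg G ω q) → wdeg G ω' v % 2 = 1 →
      wdeg G ω' s % 2 = 0 → wdeg G ω' v ≠ wdeg G ω r → IsSolution G ω' := by
    intro ω' hr' hq hv' hs' hne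
    have hev : ∀ q ∈ R.erase r, wdeg G ω' q % 2 = 0 := by
      intro q hqR
      by_cases hqs : q = s
      · rwa [hqs]
      · rw [hq q (fun h => hvR (h ▸ (Finset.mem_erase.1 hqR).2)) hqs]
        exact hωeven q hqR
    have hod : ∀ q, q ∉ R.erase r → wdeg G ω' q % 2 = 1 := by
      intro q hqR
      by_cases hqv : q = v
      · rwa [hqv]
      · rw [hq q hqv fun h => hqR (h ▸ Finset.mem_erase.2 ⟨hrs.symm, hs⟩)]
        exact hωodd q (by simp only [mem_compl, mem_insert, hqv, hqR, or_self, not_false_eq_true])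
    have hvcase : ∀ y, G.Adj v y → wdeg G ω' v ≠ wdeg G ω' y := by
      intro y hvy
      by_cases hyr : y = r
      · rw [hyr, hq r hvr.ne.symm hrs]; exact hne
      · have h1 := hev y (Finset.mem_erase.2 ⟨hyr, hvN y hvy⟩)
        omega
    refine ⟨hr', fun x y hxy => ?_⟩
    by_cases hxv : x = v
    · subst hxv; exact hvcase y hxy
    by_cases hyv : y = v
    · subst hyv; exact (hvcase x hxy.symm).symm
    by_cases hx : x ∈ R.erase r
    · by_cases hy : y ∈ R.erase r
      · exact absurd hxy (hR x (Finset.mem_erase.1 hx).2 y (Finset.mem_erase.1 hy).2)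
      · have h1 := hev x hx
        have h2 := hod y hy
        omega
    · by_cases hy : y ∈ R.erase r
      · have h1 := hev y hy
        have h2 := hod x hx
        omega
      · rw [hq x hxv fun h => hx (h ▸ Finset.mem_erase.2 ⟨hrs.symm, hs⟩),
          hq y hyv fun h => hy (h ▸ Finset.mem_erase.2 ⟨hrs.symm, hs⟩)]
        refine hωne x ?_ y ?_ hxy
        · simp only [mem_compl, mem_insert, hxv, hx, or_self, not_false_eq_true]
        · simp only [mem_compl, mem_insert, hyv, hy, or_self, not_false_eq_true]
  have hsE : s ∈ R.erase r := Finset.mem_erase.2 ⟨hrs.symm, hs⟩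
  by_cases hc : wdeg G ω v = wdeg G ω r
  swap
  · exact ⟨ω, fin ω hω (fun _ _ _ => rfl) hωv (hωeven s hsE) hc⟩
  have h13 : ω s(v, s) = 1 ∨ ω s(v, s) = 3 := eq_one_or_three_of_cast_eq_one (hω _) (by
    rw [hωj v s hvs (by
      simp only [mem_compl, mem_insert, hsE, or_true, not_true, not_false_eq_true]), hjs])
  have hws := wdeg_update_right ω hvs (4 - ω s(v, s))
  have hwv := wdeg_update_left ω hvs (4 - ω s(v, s))
  have hse := hωeven s hsE
  exact ⟨Function.update ω s(v, s) (4 - ω s(v, s)), fin _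
    (update_mem_range hω (by omega) (by omega) _)
    (fun q h1 h2 => wdeg_update_of_ne ω h1 h2 _) (by omega) (by omega) (by omega)⟩

end Exceptional

/-! ### Layers along a maximal independent set -/

section Layers

variable {V : Type*}

/-- The bipartite graph of the edges of `G` between `R` and its complement. -/
def bip (G : SimpleGraph V) (R : Finset V) : SimpleGraph V where
  Adj x y := G.Adj x y ∧ (x ∈ R ↔ y ∉ R)
  symm := ⟨fun x y h => ⟨h.1.symm, by tauto⟩⟩
  loopless := ⟨fun _ h => h.1.ne rfl⟩

/-- A connected graph has an independent set `R` such that the edges between `R` and its complement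
connect all vertices. If not all vertices are reached yet, then one that has no neighbour in `R` but
has a neighbour among the vertices reached can be added to `R`. -/
theorem exists_max_independent [Fintype V] {G : SimpleGraph V} (hG : G.Connected) (ρ : V) :
    ∃ R : Finset V, ρ ∈ R ∧ (∀ x ∈ R, ∀ y ∈ R, ¬ G.Adj x y) ∧
      (∀ x, (bip G R).Reachable ρ x) ∧ ∀ R' : Finset V, ρ ∈ R' →
        (∀ x ∈ R', ∀ y ∈ R', ¬ G.Adj x y) → (∀ x, (bip G R').Reachable ρ x) → #R' ≤ #R := by
  set Q : Finset (Finset V) := univ.filter fun R => ρ ∈ R ∧ (∀ x ∈ R, ∀ y ∈ R, ¬ G.Adj x y) ∧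
    ∀ x, (x ∈ R ∨ ∃ r ∈ R, G.Adj r x) → (bip G R).Reachable ρ x with hQ
  have memQ : ∀ R, R ∈ Q ↔ ρ ∈ R ∧ (∀ x ∈ R, ∀ y ∈ R, ¬ G.Adj x y) ∧
      ∀ x, (x ∈ R ∨ ∃ r ∈ R, G.Adj r x) → (bip G R).Reachable ρ x := fun R => by simp [hQ]
  have hne : Q.Nonempty := by
    refine ⟨{ρ}, (memQ _).2 ⟨by simp, by simp, fun x hx => ?_⟩⟩
    rcases hx with hx | ⟨r, hr, hrx⟩
    · rw [Finset.mem_singleton.1 hx]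
    · rw [Finset.mem_singleton.1 hr] at hrx
      exact SimpleGraph.Adj.reachable ⟨hrx, by simp [hrx.ne.symm]⟩
  obtain ⟨R, hRQ, hmax⟩ := Finset.exists_max_image Q Finset.card hne
  obtain ⟨hρ, hind, hreach⟩ := (memQ R).1 hRQ
  refine ⟨R, hρ, hind, ?_, fun R' h1 h2 h3 => hmax R' ((memQ R').2 ⟨h1, h2, fun x _ => h3 x⟩)⟩
  by_contra hcon
  push Not at hcon
  obtain ⟨z, hz⟩ := hcon
  obtain ⟨w⟩ := hG.preconnected ρ z
  obtain ⟨e, -, hx, hy⟩ := w.exists_boundary_dart {x | (bip G R).Reachable ρ x}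
    (SimpleGraph.Reachable.refl _) hz
  set x := e.fst
  set y := e.snd
  have hxy : G.Adj x y := e.adj
  simp only [Set.mem_ofPred_eq] at hx hy
  have hyN : ∀ r ∈ R, ¬ G.Adj r y := fun r hr h => hy (hreach y (Or.inr ⟨r, hr, h⟩))
  have hyR : y ∉ R := fun h => hy (hreach y (Or.inl h))
  have hxR : x ∉ R := fun h => hyN x h hxy
  have hup : ∀ u, (bip G R).Reachable ρ u → (bip G (insert y R)).Reachable ρ u := by
    intro u hu
    rw [SimpleGraph.reachable_iff_reflTransGen] at hu
    induction hu with
    | refl => exact SimpleGraph.Reachable.refl _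
    | @tail b c hb hbc ih =>
      rw [← SimpleGraph.reachable_iff_reflTransGen] at hb
      have hby : b ≠ y := fun h => hy (h ▸ hb)
      have hcy : c ≠ y := fun h => hy (h ▸ hb.trans (SimpleGraph.Adj.reachable hbc))
      refine ih.trans (SimpleGraph.Adj.reachable ⟨hbc.1, ?_⟩)
      simp only [mem_insert, hby, hcy, false_or]
      exact hbc.2
  have hrx := hup x hx
  have hry : (bip G (insert y R)).Reachable ρ y :=
    hrx.trans (SimpleGraph.Adj.reachable ⟨hxy, by simp [hxR, hxy.ne]⟩)
  have hbig : insert y R ∈ Q := by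
    refine (memQ _).2 ⟨mem_insert_of_mem hρ, fun u hu v hv huv => ?_, fun u hu => ?_⟩
    · rcases mem_insert.1 hu with rfl | hu
      · rcases mem_insert.1 hv with rfl | hv
        · exact huv.ne rfl
        · exact hyN v hv huv.symm
      · rcases mem_insert.1 hv with rfl | hv
        · exact hyN u hu huv
        · exact hind u hu v hv huv
    · rcases hu with hu | ⟨r, hr, hru⟩
      · rcases mem_insert.1 hu with rfl | hu
        · exact hry
        · exact hup u (hreach u (Or.inl hu))
      · rcases mem_insert.1 hr with rfl | hr
        · refine hry.trans (SimpleGraph.Adj.reachable ⟨hru, ?_⟩)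
          simp only [mem_insert, true_or, true_iff, not_or]
          exact ⟨hru.ne.symm, fun h => hyN u h hru.symm⟩
        · exact hup u (hreach u (Or.inr ⟨r, hr, hru⟩))
  have := hmax _ hbig
  rw [Finset.card_insert_of_notMem hyR] at this
  omega

/-- The vertices of `G` in layers: `R` is an independent set containing `ρ`, and `d` is the distance
from `ρ` along edges between `R` and its complement, so that `R` consists of the even layers. -/
structure Layered (G : SimpleGraph V) (R : Finset V) (ρ : V) (d : V → ℕ) : Prop where
  root : ρ ∈ R
  indep : ∀ x ∈ R, ∀ y ∈ R, ¬ G.Adj x y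
  pred_of_mem : ∀ x ∈ R, x ≠ ρ → ∃ y, y ∉ R ∧ G.Adj x y ∧ d x = d y + 1
  pred_of_notMem : ∀ x, x ∉ R → ∃ y ∈ R, G.Adj x y ∧ d x = d y + 1
  step : ∀ x ∈ R, ∀ y, y ∉ R → G.Adj x y → d y = d x + 1 ∨ d x = d y + 1
  dist_root : d ρ = 0
  mem_iff : ∀ x, x ∈ R ↔ d x % 2 = 0

theorem exists_layered [Fintype V] {G : SimpleGraph V} {R : Finset V} {ρ : V} (hρ : ρ ∈ R)
    (hind : ∀ x ∈ R, ∀ y ∈ R, ¬ G.Adj x y) (hreach : ∀ x, (bip G R).Reachable ρ x) :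
    ∃ d : V → ℕ, Layered G R ρ d := by
  set H := bip G R with hH
  have hpred : ∀ x, x ≠ ρ → ∃ y, H.Adj x y ∧ H.dist ρ x = H.dist ρ y + 1 := by
    intro x hx
    obtain ⟨w, hw⟩ := (hreach x).symm.exists_walk_length_eq_dist
    rw [SimpleGraph.dist_comm] at hw
    cases w with
    | nil => exact absurd rfl hx
    | @cons _ y _ h p =>
      refine ⟨y, h, ?_⟩
      have h1 : H.dist ρ y ≤ p.length := by
        rw [SimpleGraph.dist_comm]; exact SimpleGraph.dist_le p
      obtain ⟨q, hq⟩ := (hreach y).exists_walk_length_eq_dist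
      have h2 : H.dist ρ x ≤ H.dist ρ y + 1 := by
        rw [← hq, ← SimpleGraph.Walk.length_concat q h.symm]
        exact SimpleGraph.dist_le _
      rw [SimpleGraph.Walk.length_cons] at hw
      omega
  have hpar : ∀ n x, H.dist ρ x = n → (x ∈ R ↔ n % 2 = 0) := by
    intro n
    induction n with
    | zero =>
      intro x hx
      by_cases h : x = ρ
      · simp [h, hρ]
      · obtain ⟨y, -, hd⟩ := hpred x h
        omega
    | succ n ih =>
      intro x hx
      have hxρ : x ≠ ρ := by
        rintro rfl
        rw [SimpleGraph.dist_self] at hx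
        omega
      obtain ⟨y, hxy, hd⟩ := hpred x hxρ
      have h1 := ih y (by omega)
      rw [hxy.2, h1]
      omega
  have hle : ∀ x y, H.Adj x y → H.dist ρ y ≤ H.dist ρ x + 1 := by
    intro x y h
    obtain ⟨q, hq⟩ := (hreach x).exists_walk_length_eq_dist
    rw [← hq, ← SimpleGraph.Walk.length_concat q h]
    exact SimpleGraph.dist_le _
  refine ⟨H.dist ρ, hρ, hind, fun x hx hxρ => ?_, fun x hx => ?_, fun x hx y hy hxy => ?_,
    SimpleGraph.dist_self, fun x => hpar _ x rfl⟩
  · obtain ⟨y, h1, h2⟩ := hpred x hxρ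
    exact ⟨y, h1.2.1 hx, h1.1, h2⟩
  · obtain ⟨y, h1, h2⟩ := hpred x fun h => hx (h ▸ hρ)
    exact ⟨y, by_contra fun h => hx (h1.2.2 h), h1.1, h2⟩
  · have hadj : H.Adj x y := ⟨hxy, by simp [hx, hy]⟩
    have h1 := hle x y hadj
    have h2 := hle y x hadj.symm
    have h3 := (hpar _ x rfl).1 hx
    have h4 : ¬ H.dist ρ y % 2 = 0 := fun h => hy ((hpar _ y rfl).2 h)
    omega

/-- The labelling that is 1 on the edges from `v` to the vertices of `M`. -/
noncomputable def star (v : V) (M : Finset V) : Sym2 V → ZMod 2 := ∑ r ∈ M, Pi.single s(v, r) 1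

theorem bdry_star [Fintype V] {v : V} {M : Finset V} (h : v ∉ M) (x : V) :
    bdry (star v M) x = (if x = v then (#M : ZMod 2) else 0) + (if x ∈ M then 1 else 0) := by
  rw [star, bdry_sum, Finset.sum_congr rfl fun r hr => bdry_single (ne_of_mem_of_not_mem hr h).symm x,
    Finset.sum_add_distrib]
  congr 1
  · split_ifs <;> simp
  · simp

theorem star_apply_self (v : V) (M : Finset V) (y : V) :
    star v M s(v, y) = if y ∈ M then 1 else 0 := by
  have : ∀ r, (Pi.single s(v, r) 1 : Sym2 V → ZMod 2) s(v, y) = if y = r then 1 else 0 := by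
    intro r
    simp only [Pi.single_apply, Sym2.congr_right]
  simp [star, this]

theorem star_apply_of_ne {v x y : V} (M : Finset V) (hx : x ≠ v) (hy : y ≠ v) :
    star v M s(x, y) = 0 := by
  rw [star, Finset.sum_apply]
  refine Finset.sum_eq_zero fun r _ => ?_
  have : s(x, y) ≠ s(v, r) := by
    intro he
    rcases Sym2.eq_iff.1 he with ⟨h, -⟩ | ⟨-, h⟩
    · exact hx h
    · exact hy h
  simp [this]

theorem star_apply_of_not_adj {G : SimpleGraph V} {v : V} {M : Finset V}
    (hM : ∀ r ∈ M, G.Adj v r) (x y : V) (h : ¬ G.Adj x y) : star v M s(x, y) = 0 := by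
  by_cases hx : x = v
  · subst hx
    rw [star_apply_self, if_neg fun hy => h (hM y hy)]
  · by_cases hy : y = v
    · subst hy
      rw [Sym2.eq_swap, star_apply_self, if_neg fun hx => h (hM x hx).symm]
    · exact star_apply_of_ne M hx hy

/-- Parity labellings for the case in which `v` is the only even vertex outside `R`, with the labels
at the vertices of `Z` prescribed by `k`. -/
theorem exists_labelling [Fintype V] {G : SimpleGraph V} {R : Finset V} {ρ v : V}
    {d : V → ℕ} (hodd : #Rᶜ % 2 = 1) (hv : v ∉ R) (Z : Finset V)
    (hZ : ∀ x, x ∉ Z → x ≠ ρ → ∃ y, y ∉ Z ∧ (bip G R).Adj x y ∧ d y < d x)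
    (k : Sym2 V → ZMod 2) (hk : ∀ x y, ¬ G.Adj x y → k s(x, y) = 0)
    (hkA : ∀ x ∈ (insert v R)ᶜ, ∀ y ∈ (insert v R)ᶜ, k s(x, y) = 0)
    (hkZ : ∀ z ∈ Z, bdry k z = if z ∈ (insert v R)ᶜ then 1 else 0) :
    ∃ j : Sym2 V → ZMod 2, (∀ x y, ¬ G.Adj x y → j s(x, y) = 0) ∧
      (∀ x ∈ (insert v R)ᶜ, ∀ y ∈ (insert v R)ᶜ, j s(x, y) = 0) ∧
      (∀ q ∈ (insert v R)ᶜ, bdry j q = 1) ∧ (∀ q, q ∉ (insert v R)ᶜ → bdry j q = 0) ∧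
      ∀ x y, x ∈ Z → j s(x, y) = k s(x, y) := by
  obtain ⟨j, h1, h2, h3⟩ := exists_bdry_eq_extending (bip G R) Z ρ
    (fun x hx => reachable_del _ Z ρ d hZ x hx) k (fun x => hk x x (G.loopless.irrefl x))
    (fun z => if z ∈ (insert v R)ᶜ then 1 else 0)
    (by
      have hc : #(insert v R)ᶜ + 1 = #Rᶜ := by
        rw [Finset.compl_insert]; exact Finset.card_erase_add_one (by simpa using hv)
      rw [Finset.sum_ite_mem, Finset.univ_inter, Finset.sum_const, nsmul_one]
      have : (((#(insert v R)ᶜ : ℕ) : ℤ) : ZMod 2) = 0 := by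
        rw [cast_zmod_two_eq_zero_iff]; omega
      exact_mod_cast this)
    hkZ
  refine ⟨j, fun x y hxy => ?_, fun x hx y hy => ?_, fun q hq => ?_, fun q hq => ?_, h3⟩
  · rw [h2 x y fun hb => hxy hb.1, hk x y hxy]
  · rw [h2 x y, hkA x hx y hy]
    simp only [mem_compl, mem_insert, not_or] at hx hy
    rintro ⟨-, h4⟩
    tauto
  · rw [h1, if_pos hq]
  · rw [h1, if_neg hq]

end Layers

/-! ### The last layer -/

section LastLayers

variable {V : Type*} {G : SimpleGraph V} {R : Finset V} {ρ : V} {d : V → ℕ}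

theorem Layered.pred (h : Layered G R ρ d) {x : V} (hx : x ≠ ρ) :
    ∃ y, (bip G R).Adj x y ∧ d x = d y + 1 := by
  by_cases hxR : x ∈ R
  · obtain ⟨y, h1, h2, h3⟩ := h.pred_of_mem x hxR hx
    exact ⟨y, ⟨h2, by simp [hxR, h1]⟩, h3⟩
  · obtain ⟨y, h1, h2, h3⟩ := h.pred_of_notMem x hxR
    exact ⟨y, ⟨h2, by simp [hxR, h1]⟩, h3⟩

/-- The set of neighbours of `v` in `R`, enlarged by a neighbour outside `R` if its size is odd. -/
theorem exists_even_neighbors {v : V}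
    (hpar : #(R.filter fun r => G.Adj v r) % 2 = 0 ∨ ∃ b, b ∉ R ∧ G.Adj v b) :
    ∃ M : Finset V, (∀ x ∈ M, G.Adj v x) ∧ (∀ r ∈ R, G.Adj v r → r ∈ M) ∧
      (#M : ZMod 2) = 0 := by
  have cast0 : ∀ n : ℕ, n % 2 = 0 → (n : ZMod 2) = 0 := fun n hn => by
    have : ((n : ℤ) : ZMod 2) = 0 := by rw [cast_zmod_two_eq_zero_iff]; omega
    exact_mod_cast this
  by_cases he : #(R.filter fun r => G.Adj v r) % 2 = 0
  · exact ⟨_, fun x hx => (Finset.mem_filter.1 hx).2, fun r hr h => Finset.mem_filter.2 ⟨hr, h⟩,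
      cast0 _ he⟩
  · obtain ⟨b, hb, hvb⟩ := hpar.resolve_left he
    refine ⟨insert b (R.filter fun r => G.Adj v r), fun x hx => ?_, fun r hr h =>
      mem_insert_of_mem (Finset.mem_filter.2 ⟨hr, h⟩), cast0 _ ?_⟩
    · rcases mem_insert.1 hx with rfl | hx
      · exact hvb
      · exact (Finset.mem_filter.1 hx).2
    · rw [Finset.card_insert_of_notMem fun h => hb (Finset.mem_filter.1 h).1]
      omega

variable {D : ℕ}

/-- Removing a vertex `v` of the last layer outside `R` keeps the bipartite graph connected. -/
theorem Layered.exists_lower_of_ne_last (h : Layered G R ρ d)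
    (hdeg : ∀ x y, G.Adj x y → ∃ z, z ≠ y ∧ G.Adj x z) (hD : ∀ x, x ∉ R → d x ≤ D) {v : V}
    (hv : v ∉ R) (hvD : d v = D) {x : V} (hxρ : x ≠ ρ) :
    ∃ y, y ≠ v ∧ (bip G R).Adj x y ∧ d y < d x := by
  obtain ⟨p, hp, hd⟩ := h.pred hxρ
  by_cases hpv : p = v
  · subst hpv
    have hxR : x ∈ R := hp.2.2 hv
    obtain ⟨z, hz, hxz⟩ := hdeg x p hp.1
    have hzR : z ∉ R := fun hzR => h.indep x hxR z hzR hxz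
    have := hD z hzR
    exact ⟨z, hz, ⟨hxz, by simp [hxR, hzR]⟩, by omega⟩
  · exact ⟨p, hpv, hp, by omega⟩

variable [Fintype V]

/-- If removing `v` from the bipartite graph keeps it connected, then `v` can be the even vertex
outside `R`, with odd edges to all its neighbours in `R`, as long as its degree allows for an even
number of odd edges. -/
theorem exists_solution_of_noncut (hR : ∀ x ∈ R, ∀ y ∈ R, ¬ G.Adj x y) (hodd : #Rᶜ % 2 = 1) {v : V}
    (hv : v ∉ R)
    (hZ : ∀ x, x ≠ v → x ≠ ρ → ∃ y, y ≠ v ∧ (bip G R).Adj x y ∧ d y < d x)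
    (hm : 2 ≤ #(R.filter fun r => G.Adj v r))
    (hpar : #(R.filter fun r => G.Adj v r) % 2 = 0 ∨ ∃ b, b ∉ R ∧ G.Adj v b) :
    ∃ ω, IsSolution G ω := by
  obtain ⟨M, hM1, hM2, hM3⟩ := exists_even_neighbors hpar
  have hvM : v ∉ M := fun h => (hM1 v h).ne rfl
  obtain ⟨j, h1, h2, h3, h4, h5⟩ := exists_labelling (G := G) (d := d) (ρ := ρ) hodd hv {v}
    (fun x hx hxρ => by simpa using hZ x (by simpa using hx) hxρ) (star v M)
    (star_apply_of_not_adj hM1)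
    (fun x hx y hy => star_apply_of_ne M (fun he => by simp [he] at hx) fun he => by simp [he] at hy)
    (fun z hz => by
      rw [Finset.mem_singleton.1 hz, bdry_star hvM, if_pos rfl, hM3, if_neg hvM, if_neg (by simp)]
      simp)
  refine exists_solution_of_all_odd hR hm j h1 h2 h3 h4 fun r hr hvr => ?_
  rw [h5 v r (mem_singleton_self v), star_apply_self, if_pos (hM2 r hr hvr)]

/-- If all neighbours of `v` are in `R` and their number is odd, then `v` can be odd, with odd edges
to all its neighbours; the parity of the total is corrected by making the neighbour `r` odd too. -/
theorem exists_solution_of_noncut_pair (hR : ∀ x ∈ R, ∀ y ∈ R, ¬ G.Adj x y) (hodd : #Rᶜ % 2 = 1)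
    {v r s : V} (hv : v ∉ R) (hr : r ∈ R) (hs : s ∈ R) (hrs : r ≠ s) (hvr : G.Adj v r)
    (hvs : G.Adj v s) (hvN : ∀ x, G.Adj v x → x ∈ R)
    (hm : #(R.filter fun r => G.Adj v r) % 2 = 1)
    (hZ : ∀ x, x ≠ v → x ≠ r → x ≠ ρ →
      ∃ y, y ≠ v ∧ y ≠ r ∧ (bip G R).Adj x y ∧ d y < d x) :
    ∃ ω, IsSolution G ω := by
  set M := R.filter fun r => G.Adj v r with hM
  have memM : ∀ x, x ∈ M ↔ x ∈ R ∧ G.Adj v x := fun x => Finset.mem_filter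
  have hvM : v ∉ M := fun h => hv ((memM v).1 h).1
  have cast1 : ∀ n : ℕ, n % 2 = 1 → (n : ZMod 2) = 1 := fun n hn => by
    have : ((n : ℤ) : ZMod 2) = 1 := by rw [cast_zmod_two_eq_one_iff]; omega
    exact_mod_cast this
  have hrv : r ≠ v := hvr.ne.symm
  have hp : ∀ x, x ∈ R.erase r ∨ x ∉ R.erase r := fun x => em _
  obtain ⟨j, h1, h2, h3⟩ := exists_bdry_eq_extending (bip G R) {v, r} ρ
    (fun x hx => reachable_del _ {v, r} ρ d (fun x hx hxρ => by
      simp only [mem_insert, mem_singleton, not_or] at hx ⊢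
      obtain ⟨y, h1, h2, h3⟩ := hZ x hx.1 hx.2 hxρ
      exact ⟨y, ⟨h1, h2⟩, h3⟩) x hx) (star v M)
    (fun x => star_apply_of_not_adj (fun r hr => ((memM r).1 hr).2) x x (G.loopless.irrefl x))
    (fun z => if z ∈ (R.erase r)ᶜ then 1 else 0)
    (by
      have hc : #(R.erase r)ᶜ = #Rᶜ + 1 := by
        rw [Finset.compl_erase, Finset.card_insert_of_notMem (by simpa using hr)]
      rw [Finset.sum_ite_mem, Finset.univ_inter, Finset.sum_const, nsmul_one]
      have : (((#(R.erase r)ᶜ : ℕ) : ℤ) : ZMod 2) = 0 := by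
        rw [cast_zmod_two_eq_zero_iff]; omega
      exact_mod_cast this)
    (fun z hz => by
      rw [bdry_star hvM]
      rcases mem_insert.1 hz with rfl | hz
      · rw [if_pos rfl, if_neg hvM, cast1 _ hm, if_pos (by simp [hv]), add_zero]
      · rw [mem_singleton.1 hz, if_neg hrv, if_pos ((memM r).2 ⟨hr, hvr⟩), if_pos (by simp),
          zero_add])
  refine exists_solution_of_exchange hR hv hs hrs hvr hvs hvN j (fun x y hxy => ?_)
    (fun x hx y hy => ?_) (fun q hq => ?_) ?_ (fun q hq => ?_) ?_
  · rw [h2 x y fun hb => hxy hb.1]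
    exact star_apply_of_not_adj (fun r hr => ((memM r).1 hr).2) x y hxy
  · simp only [mem_compl, mem_insert, mem_erase, not_or, not_and] at hx hy
    by_cases hxr : x = r
    · rw [h3 x y (by simp [hxr])]
      exact star_apply_of_ne M hx.1 hy.1
    by_cases hyr : y = r
    · rw [Sym2.eq_swap, h3 y x (by simp [hyr])]
      exact star_apply_of_ne M hy.1 hx.1
    rw [h2 x y fun hb => hx.2 hxr (hb.2.2 (hy.2 hyr))]
    exact star_apply_of_ne M hx.1 hy.1
  · rw [h1, if_pos]
    simp only [mem_compl, mem_insert, not_or] at hq ⊢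
    exact hq.2
  · rw [h1, if_pos (by simp [hv])]
  · rw [h1, if_neg (by simpa using hq)]
  · rw [h3 v s (by simp), star_apply_self, if_pos ((memM s).2 ⟨hs, hvs⟩)]

/-- The vertex `u` with a single neighbour `r` in `R` can be the even vertex outside `R` if there is
a vertex `a` without neighbours outside `R` whose only odd edge is `ar`, and removing `a` and `u`
from the bipartite graph keeps it connected. -/
theorem exists_solution_of_leaf_helper (hR : ∀ x ∈ R, ∀ y ∈ R, ¬ G.Adj x y) (hodd : #Rᶜ % 2 = 1)
    {a u r : V} (ha : a ∉ R) (hu : u ∉ R) (hau : a ≠ u) (hr : r ∈ R) (har : G.Adj a r)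
    (haN : ∀ x, G.Adj a x → x ∈ R) (huniq : ∀ x ∈ R, G.Adj u x → x = r)
    (hZ : ∀ x, x ≠ a → x ≠ u → x ≠ ρ →
      ∃ y, y ≠ a ∧ y ≠ u ∧ (bip G R).Adj x y ∧ d y < d x) :
    ∃ ω, IsSolution G ω := by
  have hra : a ∉ ({r} : Finset V) := by simpa using har.ne
  have hur : u ≠ r := fun h => hu (h ▸ hr)
  obtain ⟨j, h1, h2, h3, h4, h5⟩ := exists_labelling (G := G) (d := d) (ρ := ρ) hodd hu {a, u}
    (fun x hx hxρ => by
      simp only [mem_insert, mem_singleton, not_or] at hx ⊢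
      obtain ⟨y, h1, h2, h3⟩ := hZ x hx.1 hx.2 hxρ
      exact ⟨y, ⟨h1, h2⟩, h3⟩) (star a {r})
    (star_apply_of_not_adj (by simpa using har))
    (fun x hx y hy => by
      simp only [mem_compl, mem_insert, not_or] at hx hy
      by_cases hxa : x = a
      · have hyr : y ≠ r := fun h => hy.2 (h ▸ hr)
        rw [hxa, star_apply_self, if_neg (by simpa using hyr)]
      by_cases hya : y = a
      · have hxr : x ≠ r := fun h => hx.2 (h ▸ hr)
        rw [hya, Sym2.eq_swap, star_apply_self, if_neg (by simpa using hxr)]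
      exact star_apply_of_ne _ hxa hya)
    (fun z hz => by
      rw [bdry_star hra]
      rcases mem_insert.1 hz with rfl | hz
      · rw [if_pos rfl, if_neg hra, if_pos (by simp [ha, hau])]; simp
      · rw [mem_singleton.1 hz, if_neg hau.symm, if_neg (by simpa using hur), if_neg (by simp),
          add_zero])
  refine exists_solution_of_helper hR hu hr huniq ha hau har haN j h1 h2 h3 h4 ?_
  rw [h5 a r (by simp), star_apply_self, if_pos (mem_singleton_self r)]

/-- If there is no solution, then the last layer lies outside `R`. -/
theorem Layered.lt_of_mem (h : Layered G R ρ d) (hodd : #Rᶜ % 2 = 1)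
    (hdeg : ∀ x y, G.Adj x y → ∃ z, z ≠ y ∧ G.Adj x z) (hD : ∀ x, x ∉ R → d x ≤ D)
    (hDodd : D % 2 = 1) (hno : ¬ ∃ ω, IsSolution G ω) {r : V} (hr : r ∈ R) : d r < D := by
  by_contra hlt
  have hrD : D < d r := by
    have := (h.mem_iff r).1 hr
    omega
  have hrρ : r ≠ ρ := by
    rintro rfl
    rw [h.dist_root] at hrD
    omega
  obtain ⟨v, hv, hrv, hdv⟩ := h.pred_of_mem r hr hrρ
  have hvD : d v = D := by
    have := hD v hv
    omega
  obtain ⟨s, hs, hvs, hds⟩ := h.pred_of_notMem v hv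
  have hrs : r ≠ s := by
    rintro rfl
    omega
  have hm : 2 ≤ #(R.filter fun r => G.Adj v r) := by
    rw [← Finset.card_pair hrs]
    refine Finset.card_le_card fun x hx => ?_
    rcases mem_insert.1 hx with rfl | hx
    · exact mem_filter.2 ⟨hr, hrv.symm⟩
    · rw [mem_singleton.1 hx]; exact mem_filter.2 ⟨hs, hvs⟩
  have hc := fun x (_ : x ≠ v) (hx : x ≠ ρ) => h.exists_lower_of_ne_last hdeg hD hv hvD hx
  by_cases hpar : #(R.filter fun r => G.Adj v r) % 2 = 0 ∨ ∃ b, b ∉ R ∧ G.Adj v b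
  · exact hno (exists_solution_of_noncut h.indep hodd hv hc hm hpar)
  push Not at hpar
  refine hno (exists_solution_of_noncut_pair (ρ := ρ) (d := d) h.indep hodd hv hr hs hrs hrv.symm
    hvs (fun x hx => by_contra fun hxR => hpar.2 x hxR hx) (by omega) fun x hxv hxr hxρ => ?_)
  obtain ⟨y, hyv, hxy, hlt⟩ := hc x hxv hxρ
  refine ⟨y, hyv, ?_, hxy, hlt⟩
  rintro rfl
  have := hD x fun hxR => hxy.2.1 hxR hr
  omega

/-- If there is no solution, then each vertex of the last layer has a single neighbour in `R`. -/
theorem Layered.eq_of_last (h : Layered G R ρ d) (hodd : #Rᶜ % 2 = 1)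
    (hdeg : ∀ x y, G.Adj x y → ∃ z, z ≠ y ∧ G.Adj x z) (hD : ∀ x, x ∉ R → d x ≤ D)
    (hDR : ∀ x ∈ R, d x < D) (hno : ¬ ∃ ω, IsSolution G ω) {v r s : V} (hv : v ∉ R)
    (hvD : d v = D) (hr : r ∈ R) (hs : s ∈ R) (hvr : G.Adj v r) (hvs : G.Adj v s) : r = s := by
  by_contra hrs
  have hm : 2 ≤ #(R.filter fun r => G.Adj v r) := by
    rw [← Finset.card_pair hrs]
    refine Finset.card_le_card fun x hx => ?_
    rcases mem_insert.1 hx with rfl | hx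
    · exact mem_filter.2 ⟨hr, hvr⟩
    · rw [mem_singleton.1 hx]; exact mem_filter.2 ⟨hs, hvs⟩
  have hc := fun x (_ : x ≠ v) (hx : x ≠ ρ) => h.exists_lower_of_ne_last hdeg hD hv hvD hx
  by_cases hpar : #(R.filter fun r => G.Adj v r) % 2 = 0 ∨ ∃ b, b ∉ R ∧ G.Adj v b
  · exact hno (exists_solution_of_noncut h.indep hodd hv hc hm hpar)
  push Not at hpar
  have hvN : ∀ x, G.Adj v x → x ∈ R := fun x hx => by_contra fun hxR => hpar.2 x hxR hx
  by_cases hleaf : ∃ u, u ∉ R ∧ u ≠ v ∧ G.Adj u r ∧ ∀ x ∈ R, G.Adj u x → x = r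
  · obtain ⟨u, hu, huv, hur, huniq⟩ := hleaf
    refine hno (exists_solution_of_leaf_helper (ρ := ρ) (d := d) h.indep hodd hv hu huv.symm hr
      hvr hvN huniq fun x hxv hxu hxρ => ?_)
    obtain ⟨y, hyv, hxy, hlt⟩ := hc x hxv hxρ
    refine ⟨y, hyv, ?_, hxy, hlt⟩
    rintro rfl
    -- the only neighbour of `u` in `R` is closer to the root than `u`
    have hxr := huniq x (hxy.2.2 hu) hxy.1.symm
    obtain ⟨p, hp, hup, hdp⟩ := h.pred_of_notMem y hu
    have := huniq p hp hup
    subst hxr this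
    omega
  · push Not at hleaf
    refine hno (exists_solution_of_noncut_pair (ρ := ρ) (d := d) h.indep hodd hv hr hs hrs hvr
      hvs hvN (by omega) fun x hxv hxr hxρ => ?_)
    obtain ⟨p, hp, hd⟩ := h.pred hxρ
    by_cases hpv : p = v
    · subst hpv
      have := hDR x (hp.2.2 hv)
      omega
    by_cases hpr : p = r
    · subst hpr
      have hxR : x ∉ R := fun hxR => hp.2.1 hxR hr
      obtain ⟨y, hy, hxy, hyr⟩ := hleaf x hxR hxv hp.1
      refine ⟨y, fun he => hv (he ▸ hy), hyr, ⟨hxy, by simp [hxR, hy]⟩, ?_⟩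
      have h1 := hDR y hy
      have h2 := h.step p hr v hv hvr.symm
      have h3 := hDR p hr
      omega
    · exact ⟨p, hpv, hpr, hp, by omega⟩

/-- If there is no solution, then a vertex of the last layer lies in no triangle with a vertex of
`R`. -/
theorem Layered.not_adj_of_last (h : Layered G R ρ d) (hodd : #Rᶜ % 2 = 1)
    (hdeg : ∀ x y, G.Adj x y → ∃ z, z ≠ y ∧ G.Adj x z) (hD : ∀ x, x ∉ R → d x ≤ D)
    (hDR : ∀ x ∈ R, d x < D) (hno : ¬ ∃ ω, IsSolution G ω) {v r b : V} (hv : v ∉ R)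
    (hvD : d v = D) (hr : r ∈ R) (hvr : G.Adj v r) (hvb : G.Adj v b) : ¬ G.Adj b r := by
  intro hbr
  obtain ⟨j, h1, h2, h3, h4, h5⟩ := exists_labelling (G := G) (d := d) (ρ := ρ) hodd hv {v}
    (fun x hx hxρ => by simpa using h.exists_lower_of_ne_last hdeg hD hv hvD hxρ) 0
    (fun _ _ _ => rfl) (fun _ _ _ _ => rfl)
    (fun z hz => by rw [mem_singleton.1 hz, if_neg (by simp)]; simp [bdry])
  exact hno (exists_solution_of_triangle h.indep hr hvr
    (fun x hx hvx => h.eq_of_last hodd hdeg hD hDR hno hv hvD hx hr hvx hvr) hvb hbr j h1 h2 h3 h4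
    fun x => h5 v x (mem_singleton_self v))

end LastLayers

/-! ### The layers before the last one -/

section LowerLayers

variable {V : Type*} [Fintype V] {G : SimpleGraph V} {R : Finset V} {ρ : V} {d : V → ℕ} {D : ℕ}

/-- If `r` and its lower neighbour `a` lie below the last layer and all other neighbours of `r` are
in the last layer, then there is at most one such neighbour: otherwise replacing `r` in `R` by them
would give a larger independent set. -/
theorem Layered.eq_of_last_of_maximal (h : Layered G R ρ d) (hodd : #Rᶜ % 2 = 1)
    (hdeg : ∀ x y, G.Adj x y → ∃ z, z ≠ y ∧ G.Adj x z) (hD : ∀ x, x ∉ R → d x ≤ D)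
    (hDR : ∀ x ∈ R, d x < D) (hno : ¬ ∃ ω, IsSolution G ω)
    (hmax : ∀ R' : Finset V, ρ ∈ R' → (∀ x ∈ R', ∀ y ∈ R', ¬ G.Adj x y) →
      (∀ x, (bip G R').Reachable ρ x) → #R' ≤ #R)
    {a r : V} (hr : r ∈ R) (hdr : d r = d a + 1) (hlast : ∀ y, G.Adj r y → y = a ∨ d y = D)
    {x y : V} (hx : G.Adj r x) (hxa : x ≠ a) (hy : G.Adj r y) (hya : y ≠ a) : x = y := by
  by_contra hxy
  set L := univ.filter fun z => G.Adj r z ∧ z ≠ a with hL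
  have memL : ∀ z, z ∈ L ↔ G.Adj r z ∧ z ≠ a := fun z => by simp [hL]
  have hLR : ∀ z ∈ L, z ∉ R := fun z hz hzR => h.indep r hr z hzR ((memL z).1 hz).1
  have hLD : ∀ z ∈ L, d z = D := fun z hz =>
    (hlast z ((memL z).1 hz).1).resolve_left ((memL z).1 hz).2
  have hrL : r ∉ L := fun hrL => hLR r hrL hr
  have hLu : ∀ z ∈ L, ∀ s ∈ R, G.Adj z s → s = r := fun z hz s hs hzs =>
    h.eq_of_last hodd hdeg hD hDR hno (hLR z hz) (hLD z hz) hs hr hzs ((memL z).1 hz).1.symm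
  have hLL : ∀ z ∈ L, ∀ b ∈ L, ¬ G.Adj z b := fun z hz b hb hzb =>
    h.not_adj_of_last hodd hdeg hD hDR hno (hLR z hz) (hLD z hz) hr ((memL z).1 hz).1.symm hzb
      ((memL b).1 hb).1.symm
  set R' := R.erase r ∪ L with hR'
  have memR' : ∀ z, z ∈ R' ↔ (z ≠ r ∧ z ∈ R) ∨ z ∈ L := fun z => by simp [hR']
  have hrR' : r ∉ R' := by simp [memR', hrL]
  have hcard : #R < #R' := by
    have h2 : 2 ≤ #L := by
      rw [← Finset.card_pair hxy]
      refine Finset.card_le_card fun z hz => ?_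
      rcases mem_insert.1 hz with rfl | hz
      · exact (memL z).2 ⟨hx, hxa⟩
      · rw [mem_singleton.1 hz]; exact (memL y).2 ⟨hy, hya⟩
    rw [hR', Finset.card_union_of_disjoint
      (Finset.disjoint_right.2 fun z hz hzR => hLR z hz (mem_of_mem_erase hzR))]
    have := Finset.card_erase_add_one hr
    omega
  have hdel : ∀ z, z ∉ insert r L → (bip G R').Reachable ρ z := by
    intro z hz
    refine (reachable_del (bip G R) (insert r L) ρ d (fun x hx hxρ => ?_) z hz).mono ?_
    · simp only [mem_insert, not_or] at hx ⊢
      obtain ⟨p, hp, hdp⟩ := h.pred hxρ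
      refine ⟨p, ⟨?_, fun hpL => ?_⟩, hp, by omega⟩
      · rintro rfl
        have hxa : x = a := by_contra fun hxa => hx.2 ((memL x).2 ⟨hp.1.symm, hxa⟩)
        subst hxa
        omega
      · have h1 := hLD p hpL
        have h2 := hDR x (hp.2.2 (hLR p hpL))
        omega
    · intro x y hxy
      obtain ⟨⟨h1, h2⟩, h3, h4⟩ := hxy
      simp only [mem_insert, not_or] at h3 h4
      refine ⟨h1, ?_⟩
      simp only [memR', h3, h4, ne_eq, not_false_eq_true, true_and, or_false]
      exact h2
  have hL' : ∀ z ∈ L, (bip G R').Reachable ρ z := by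
    intro z hz
    obtain ⟨b, hbr, hzb⟩ := hdeg z r ((memL z).1 hz).1.symm
    have hbL : b ∉ L := fun hb => hLL z hz b hb hzb
    have hbR : b ∉ R := fun hb => hbr (hLu z hz b hb hzb)
    refine (hdel b (by simp [hbr, hbL])).trans (SimpleGraph.Adj.reachable ⟨hzb.symm, ?_⟩)
    simp [memR', hbR, hbL, hz]
  refine hcard.not_ge (hmax R' ((memR' ρ).2 (Or.inl ⟨?_, h.root⟩)) (fun z hz b hb hzb => ?_)
    fun z => ?_)
  · rintro rfl
    have := h.dist_root
    omega
  · rcases (memR' z).1 hz with hz | hz <;> rcases (memR' b).1 hb with hb | hb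
    · exact h.indep z hz.2 b hb.2 hzb
    · exact hz.1 (hLu b hb z hz.2 hzb.symm)
    · exact hb.1 (hLu z hz b hb.2 hzb)
    · exact hLL z hz b hb hzb
  · by_cases hzL : z ∈ L
    · exact hL' z hzL
    by_cases hzr : z = r
    · subst hzr
      have hxL : x ∈ L := (memL x).2 ⟨hx, hxa⟩
      refine (hL' x hxL).trans (SimpleGraph.Adj.reachable ⟨hx.symm, ?_⟩)
      simp [hrR', memR', hxL]
    · exact hdel z (by simp [hzr, hzL])

/-- The case of an odd number of vertices outside `R`. A vertex `v` of the last layer hangs on a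
single vertex `r` of `R`, whose lower neighbour is `a`. Apart from the vertices of `R` in `S`, which
hang on `a` and carry one vertex of the last layer each, removing `a` disconnects nothing, so the
even vertex can be `a` itself, or a vertex of the last layer with `a` as helper. -/
theorem Layered.exists_solution (h : Layered G R ρ d) (hodd : #Rᶜ % 2 = 1)
    (hdeg : ∀ x y, G.Adj x y → ∃ z, z ≠ y ∧ G.Adj x z)
    (hmax : ∀ R' : Finset V, ρ ∈ R' → (∀ x ∈ R', ∀ y ∈ R', ¬ G.Adj x y) →
      (∀ x, (bip G R').Reachable ρ x) → #R' ≤ #R) : ∃ ω, IsSolution G ω := by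
  by_contra hno
  have hne : (Rᶜ).Nonempty := by
    rw [← Finset.card_pos]
    omega
  obtain ⟨v, hv, hvmax⟩ := Finset.exists_max_image Rᶜ d hne
  rw [mem_compl] at hv
  obtain ⟨D, hvD⟩ : ∃ D, d v = D := ⟨_, rfl⟩
  have hD : ∀ x, x ∉ R → d x ≤ D := fun x hx => hvD ▸ hvmax x (mem_compl.2 hx)
  have hDodd : D % 2 = 1 := by
    have := (h.mem_iff v).not.1 hv
    omega
  have hDR : ∀ x ∈ R, d x < D := fun x hx => h.lt_of_mem hodd hdeg hD hDodd hno hx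
  obtain ⟨r, hr, hvr, hdr⟩ := h.pred_of_notMem v hv
  have hvuniq : ∀ s ∈ R, G.Adj v s → s = r := fun s hs hvs =>
    h.eq_of_last hodd hdeg hD hDR hno hv hvD hs hr hvs hvr
  have hrρ : r ≠ ρ := by
    rintro rfl
    obtain ⟨b, hbr, hvb⟩ := hdeg v r hvr
    have hb : b ∉ R := fun hb => hbr (hvuniq b hb hvb)
    obtain ⟨s, hs, hbs, hds⟩ := h.pred_of_notMem b hb
    have h1 := hD b hb
    have h2 := h.dist_root
    have hsr : s = r := by
      by_contra hsr
      obtain ⟨y, -, -, hy⟩ := h.pred_of_mem s hs hsr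
      omega
    exact h.not_adj_of_last hodd hdeg hD hDR hno hv hvD hr hvr hvb (hsr ▸ hbs)
  obtain ⟨a, ha, hra, hda⟩ := h.pred_of_mem r hr hrρ
  set S := R.filter fun s => G.Adj a s ∧ ∀ y, G.Adj s y → y = a ∨ d y = D with hS
  have memS : ∀ s, s ∈ S ↔ s ∈ R ∧ G.Adj a s ∧ ∀ y, G.Adj s y → y = a ∨ d y = D := fun s =>
    Finset.mem_filter
  have hleaf : ∀ s ∈ S, ∃ u, G.Adj s u ∧ u ≠ a ∧ u ∉ R ∧ d u = D ∧ d s = d a + 1 ∧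
      (∀ t ∈ R, G.Adj u t → t = s) ∧ ∀ y, G.Adj s y → y = a ∨ y = u := by
    intro s hs
    obtain ⟨hsR, has, hlast⟩ := (memS s).1 hs
    obtain ⟨u, hua, hsu⟩ := hdeg s a has.symm
    have huD := (hlast u hsu).resolve_left hua
    have huR : u ∉ R := fun hu => h.indep s hsR u hu hsu
    have hds : d s = d a + 1 := by
      have h1 := h.step s hsR u huR hsu
      have h2 := hDR s hsR
      omega
    refine ⟨u, hsu, hua, huR, huD, hds, fun t ht hut =>
      h.eq_of_last hodd hdeg hD hDR hno huR huD ht hsR hut hsu.symm, fun y hy => ?_⟩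
    by_cases hya : y = a
    · exact Or.inl hya
    · exact Or.inr (h.eq_of_last_of_maximal hodd hdeg hD hDR hno hmax hsR hds hlast hy hya hsu hua)
  -- A neighbour of `a` outside `S` is still connected to the root when `a` is removed.
  have hnotS : ∀ x, (bip G R).Adj x a → x ∉ S → d x = d a + 1 →
      ∃ y, y ≠ a ∧ y ∉ R ∧ d y ≠ D ∧ (bip G R).Adj x y ∧ d y < d x := by
    intro x hxa hxS hdx
    have hxR : x ∈ R := hxa.2.2 ha
    have : ∃ y, G.Adj x y ∧ y ≠ a ∧ d y ≠ D := by
      by_contra hcon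
      push Not at hcon
      exact hxS ((memS x).2 ⟨hxR, hxa.1.symm, fun y hy => or_iff_not_imp_left.2 (hcon y hy)⟩)
    obtain ⟨y, hxy, hya, hyD⟩ := this
    have hyR : y ∉ R := fun hy => h.indep x hxR y hy hxy
    refine ⟨y, hya, hyR, hyD, ⟨hxy, by simp [hxR, hyR]⟩, ?_⟩
    have h1 := h.step x hxR y hyR hxy
    omega
  have hlow : ∀ p, d p = D → p ∉ R → ∀ x, (bip G R).Adj x p → d x ≠ d p + 1 := by
    intro p hpD hpR x hxp hdx
    have := hDR x (hxp.2.2 hpR)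
    omega
  by_cases hab : ∃ b, b ∉ R ∧ G.Adj a b
  · choose! lf hlf using hleaf
    obtain ⟨M, hM1, hM2, hM3⟩ := exists_even_neighbors (R := R) (Or.inr hab)
    have haM : a ∉ M := fun hh => (hM1 a hh).ne rfl
    obtain ⟨s, hs, has, hds⟩ := h.pred_of_notMem a ha
    have hrs : r ≠ s := by
      rintro rfl
      omega
    have hm : 2 ≤ #(R.filter fun r => G.Adj a r) := by
      rw [← Finset.card_pair hrs]
      refine Finset.card_le_card fun x hx => ?_
      rcases mem_insert.1 hx with rfl | hx
      · exact mem_filter.2 ⟨hr, hra.symm⟩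
      · rw [mem_singleton.1 hx]; exact mem_filter.2 ⟨hs, has⟩
    have hSR : ∀ s ∈ S, s ∈ R := fun s hs => ((memS s).1 hs).1
    have hSa : ∀ s ∈ S, s ≠ a := fun s hs he => ha (he ▸ hSR s hs)
    have hlfS : ∀ s ∈ S, ∀ t ∈ S, lf s ≠ t := fun s hs t ht he => (hlf s hs).2.2.1 (he ▸ hSR t ht)
    have hlfM : ∀ s ∈ S, lf s ∉ M := fun s hs hsM => by
      obtain ⟨h1, h2, h3, h4, -⟩ := hlf s hs
      exact h.not_adj_of_last hodd hdeg hD hDR hno h3 h4 (hSR s hs) h1.symm (hM1 _ hsM).symm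
        ((memS s).1 hs).2.1
    have hlfinj : ∀ s ∈ S, ∀ t ∈ S, lf s = lf t → s = t := fun s hs t ht he =>
      (hlf t ht).2.2.2.2.2.1 s (hSR s hs) (he ▸ (hlf s hs).1.symm)
    have hstar : ∀ s ∈ S, s ∉ ({lf s} : Finset V) := fun s hs hh =>
      hlfS s hs s hs (mem_singleton.1 hh).symm
    -- The odd edges are those from `a` to `M` and those from the vertices of `S` to their leaves.
    set k : Sym2 V → ZMod 2 := star a M + ∑ s ∈ S, star s {lf s} with hk
    have hkb : ∀ z, bdry k z = ((if z = a then (#M : ZMod 2) else 0) + (if z ∈ M then 1 else 0)) +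
        ((if z ∈ S then 1 else 0) + ∑ s ∈ S, if z = lf s then 1 else 0) := by
      intro z
      rw [hk, bdry_add, bdry_star haM, bdry_sum,
        Finset.sum_congr rfl fun s hs => bdry_star (hstar s hs) z, Finset.sum_add_distrib]
      simp
    obtain ⟨j, h1, h2, h3, h4, h5⟩ := exists_labelling (G := G) (d := d) (ρ := ρ) hodd ha
      (insert a (S ∪ S.image lf))
      (fun x hx hxρ => by
        simp only [mem_insert, mem_union, mem_image, not_or, not_exists, not_and] at hx ⊢
        obtain ⟨p, hp, hdp⟩ := h.pred hxρ
        by_cases hpa : p = a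
        · subst hpa
          obtain ⟨y, h1, h2, h3, h4, h5⟩ := hnotS x hp hx.2.1 hdp
          exact ⟨y, ⟨h1, fun hy => h2 (hSR y hy), fun s hs he => h3 (he ▸ (hlf s hs).2.2.2.1)⟩,
            h4, h5⟩
        · refine ⟨p, ⟨hpa, fun hpS => ?_, fun s hs he => ?_⟩, hp, by omega⟩
          · rcases (hlf p hpS).2.2.2.2.2.2 x hp.1.symm with he | he
            · exact hx.1 he
            · exact hx.2.2 p hpS he.symm
          · exact hlow p (he ▸ (hlf s hs).2.2.2.1) (he ▸ (hlf s hs).2.2.1) x hp hdp)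
      k
      (fun x y hxy => by
        rw [hk, Pi.add_apply, star_apply_of_not_adj hM1 x y hxy, zero_add, Finset.sum_apply]
        exact Finset.sum_eq_zero fun s hs =>
          star_apply_of_not_adj (by simpa using (hlf s hs).1) x y hxy)
      (fun x hx y hy => by
        simp only [mem_compl, mem_insert, not_or] at hx hy
        rw [hk, Pi.add_apply, star_apply_of_ne M hx.1 hy.1, zero_add, Finset.sum_apply]
        exact Finset.sum_eq_zero fun s hs => star_apply_of_ne _ (fun he => hx.2 (he ▸ hSR s hs))
          fun he => hy.2 (he ▸ hSR s hs))
      (fun z hz => by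
        rw [hkb]
        rcases mem_insert.1 hz with rfl | hz
        · rw [if_pos rfl, hM3, if_neg haM, if_neg fun hh => hSa _ hh rfl,
            Finset.sum_eq_zero fun s hs => if_neg (hlf s hs).2.1.symm, if_neg (by simp)]
          simp
        rcases mem_union.1 hz with hz | hz
        · rw [if_neg (hSa z hz), if_pos (hM2 z (hSR z hz) ((memS z).1 hz).2.1), if_pos hz,
            Finset.sum_eq_zero fun s hs => if_neg (hlfS s hs z hz).symm, if_neg (by simp [hSR z hz])]
          decide
        · obtain ⟨s, hs, rfl⟩ := mem_image.1 hz
          rw [if_neg (hlf s hs).2.1, if_neg (hlfM s hs), if_neg fun hh => hlfS s hs _ hh rfl,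
            Finset.sum_eq_single_of_mem s hs fun t ht hts => if_neg fun he =>
              hts (hlfinj s hs t ht he).symm, if_pos rfl,
            if_pos (by simp [(hlf s hs).2.1, (hlf s hs).2.2.1])]
          simp)
    refine hno (exists_solution_of_all_odd h.indep hm j h1 h2 h3 h4 fun t ht hat => ?_)
    rw [h5 a t (mem_insert_self _ _), hk, Pi.add_apply, star_apply_self, if_pos (hM2 t ht hat),
      Finset.sum_apply, Finset.sum_eq_zero, add_zero]
    intro s hs
    by_cases hts : t = s
    · rw [hts, Sym2.eq_swap, star_apply_self, if_neg]
      simpa using (hlf s hs).2.1.symm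
    · exact star_apply_of_ne _ (hSa s hs).symm hts
  · push Not at hab
    have haN : ∀ x, G.Adj a x → x ∈ R := fun x hx => by_contra fun hxR => hab x hxR hx
    rcases S.eq_empty_or_nonempty with hemp | ⟨s, hs⟩
    · refine hno (exists_solution_of_leaf_helper (ρ := ρ) (d := d) h.indep hodd ha hv
        (fun he => ?_) hr hra.symm haN hvuniq fun x hxa hxv hxρ => ?_)
      · subst he
        omega
      · obtain ⟨p, hp, hdp⟩ := h.pred hxρ
        by_cases hpa : p = a
        · subst hpa
          obtain ⟨y, h1, h2, h3, h4, h5⟩ := hnotS x hp (by simp [hemp]) hdp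
          exact ⟨y, h1, fun he => h3 (he ▸ hvD), h4, h5⟩
        · refine ⟨p, hpa, ?_, hp, by omega⟩
          rintro rfl
          exact hlow p hvD hv x hp hdp
    · obtain ⟨hsR, has, -⟩ := (memS s).1 hs
      obtain ⟨u, hsu, hua, huR, huD, hds, huuniq, hsN⟩ := hleaf s hs
      obtain ⟨b, hbs, hub⟩ := hdeg u s hsu.symm
      have hbR : b ∉ R := fun hb => hbs (huuniq b hb hub)
      have hsM : s ∉ ({u, a} : Finset V) := by simp [hsu.ne, has.ne.symm]
      have huM : u ∉ ({b} : Finset V) := by simpa using hub.ne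
      obtain ⟨j, h1, h2, h3, h4, h5⟩ := exists_labelling (G := G) (d := d) (ρ := ρ) hodd huR
        {u, s}
        (fun x hx hxρ => by
          simp only [mem_insert, mem_singleton, not_or] at hx ⊢
          obtain ⟨p, hp, hdp⟩ := h.pred hxρ
          refine ⟨p, ⟨?_, ?_⟩, hp, by omega⟩
          · rintro rfl
            exact hlow p huD huR x hp hdp
          · rintro rfl
            rcases hsN x hp.1.symm with he | he
            · subst he
              omega
            · exact hx.1 he)
        -- the odd edges `su`, `sa` and `ub`
        (star s {u, a} + star u {b})
        (fun x y hxy => by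
          rw [Pi.add_apply, star_apply_of_not_adj (by simpa using ⟨hsu, has.symm⟩) x y hxy,
            star_apply_of_not_adj (by simpa using hub) x y hxy, add_zero])
        (fun x hx y hy => by
          simp only [mem_compl, mem_insert, not_or] at hx hy
          have hxs : x ≠ s := fun he => hx.2 (he ▸ hsR)
          have hys : y ≠ s := fun he => hy.2 (he ▸ hsR)
          rw [Pi.add_apply, star_apply_of_ne _ hxs hys, star_apply_of_ne _ hx.1 hy.1, add_zero])
        (fun z hz => by
          rw [bdry_add, bdry_star hsM, bdry_star huM]
          rcases mem_insert.1 hz with rfl | hz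
          · rw [if_neg hsu.ne.symm, if_pos (by simp), if_pos rfl, if_neg huM, if_neg (by simp)]
            simp only [card_singleton]
            decide
          · rw [mem_singleton.1 hz, if_pos rfl, if_neg hsM, if_neg hsu.ne,
              if_neg (by simpa using hbs.symm), if_neg (by simp [hsR]), Finset.card_pair hua]
            decide)
      refine hno (exists_solution_of_helper h.indep huR hsR huuniq ha hua.symm has haN j
        h1 h2 h3 h4 ?_)
      rw [Sym2.eq_swap, h5 s a (by simp), Pi.add_apply, star_apply_self, if_pos (by simp),
        star_apply_of_ne _ hsu.ne hua.symm, add_zero]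

end LowerLayers

/-! ### Connected graphs and components -/

section Components

variable {V : Type*}

/-- If all vertices outside `R` are odd, then by parity at most `ρ` can be odd among the vertices of
`R`, which is harmless when `ρ` is a leaf: its weighted degree is smaller than that of its
neighbour. -/
theorem exists_solution_of_even_or_leaf [Fintype V] {G : SimpleGraph V} {R : Finset V} {ρ : V}
    (hρ : ρ ∈ R) (hR : ∀ x ∈ R, ∀ y ∈ R, ¬ G.Adj x y) (hreach : ∀ x, (bip G R).Reachable ρ x)
    (h : #Rᶜ % 2 = 0 ∨ ∃ y z, G.Adj y z ∧ z ≠ ρ ∧ ∀ x, G.Adj ρ x → x = y) :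
    ∃ ω, IsSolution G ω := by
  obtain ⟨j, h1, h2⟩ := exists_bdry_eq (bip G R) ρ
    (fun x => (if x ∈ Rᶜ then 1 else 0) + (if x = ρ then (#Rᶜ : ZMod 2) else 0))
    (fun x _ => hreach x) (by
      rw [Finset.sum_add_distrib, Finset.sum_ite_mem, Finset.univ_inter, Finset.sum_const, nsmul_one,
        Finset.sum_ite_eq' univ, if_pos (mem_univ _), CharTwo.add_self_eq_zero])
  have hj : ∀ x y, ¬ G.Adj x y → j s(x, y) = 0 := fun x y hxy => h1 x y fun hb => hxy hb.1
  have hodd : ∀ q ∈ Rᶜ, bdry j q = 1 := fun q hq => by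
    rw [h2, if_pos hq, if_neg, add_zero]
    rintro rfl
    exact mem_compl.1 hq hρ
  obtain ⟨ω, hω, hωj, hωodd, hωne⟩ := exists_weighting_of_parity G Rᶜ j hj
    (fun x hx y hy => h1 x y fun hb => mem_compl.1 hx (hb.2.2 (mem_compl.1 hy))) hodd
  have key : ∀ x ∈ R, ∀ y ∈ Rᶜ, G.Adj x y → wdeg G ω x ≠ wdeg G ω y := by
    intro x hx y hy hxy
    have heven : bdry j x = 0 → wdeg G ω x ≠ wdeg G ω y := by
      intro h0
      rw [← wdeg_cast_eq_bdry G _ j hj ω hωj x (by simpa using hx),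
        cast_zmod_two_eq_zero_iff] at h0
      have := hωodd y hy
      omega
    by_cases hxρ : x = ρ
    swap
    · exact heven (by rw [h2, if_neg (by simpa using hx), if_neg hxρ, add_zero])
    subst hxρ
    rcases h with h | ⟨y', z, hyz, hzx, hleaf⟩
    · refine heven ?_
      rw [h2, if_neg (by simpa using hx), if_pos rfl, zero_add]
      have : (((#Rᶜ : ℕ) : ℤ) : ZMod 2) = 0 := by
        rw [cast_zmod_two_eq_zero_iff]; omega
      exact_mod_cast this
    · obtain rfl := hleaf y hxy
      have hx' : wdeg G ω x = ω s(x, y) := by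
        rw [wdeg, Finset.sum_eq_single y (fun u _ hu => if_neg fun hxu => hu (hleaf u hxu))
          (fun hn => absurd (mem_univ y) hn), if_pos hxy]
      have hy' : ω s(y, x) + ω s(y, z) ≤ wdeg G ω y := by
        have := Finset.sum_le_sum_of_subset_of_nonneg (subset_univ ({x, z} : Finset V))
          (f := fun u => if G.Adj y u then ω s(y, u) else 0) fun u _ _ => by
            have := hω s(y, u)
            split_ifs <;> omega
        rw [Finset.sum_pair hzx.symm, if_pos hxy.symm, if_pos hyz] at this
        exact this
      rw [Sym2.eq_swap] at hx'
      have := hω s(y, z)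
      omega
  refine ⟨ω, hω, fun x y hxy => ?_⟩
  by_cases hx : x ∈ R <;> by_cases hy : y ∈ R
  · exact absurd hxy (hR x hx y hy)
  · exact key x hx y (mem_compl.2 hy) hxy
  · exact (key y hy x (mem_compl.2 hx) hxy.symm).symm
  · exact hωne x (mem_compl.2 hx) y (mem_compl.2 hy) hxy

theorem exists_solution_of_connected [Fintype V] {G : SimpleGraph V} (hG : G.Connected)
    (hK2 : ∀ x y, G.Adj x y → (∀ z, G.Adj x z → z = y) → ∃ z, z ≠ x ∧ G.Adj y z) :
    ∃ ω, IsSolution G ω := by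
  by_cases hl : ∃ x y, G.Adj x y ∧ ∀ z, G.Adj x z → z = y
  · obtain ⟨x, y, hxy, hu⟩ := hl
    obtain ⟨z, hz, hyz⟩ := hK2 x y hxy hu
    obtain ⟨R, h1, h2, h3, -⟩ := exists_max_independent hG x
    exact exists_solution_of_even_or_leaf h1 h2 h3 (Or.inr ⟨y, z, hyz, hz, hu⟩)
  · push Not at hl
    obtain ⟨ρ⟩ := hG.nonempty
    obtain ⟨R, h1, h2, h3, h4⟩ := exists_max_independent hG ρ
    obtain ⟨d, hd⟩ := exists_layered h1 h2 h3
    rcases Nat.mod_two_eq_zero_or_one #Rᶜ with h | h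
    · exact exists_solution_of_even_or_leaf h1 h2 h3 (Or.inl h)
    · exact hd.exists_solution h (fun x y hxy => (hl x y hxy).imp fun z hz => ⟨hz.2, hz.1⟩) h4

theorem nonempty_iso_completeGraph_two {G : SimpleGraph V} (hG : G.Connected) {x y : V}
    (hxy : G.Adj x y) (hx : ∀ z, G.Adj x z → z = y) (hy : ∀ z, G.Adj y z → z = x) :
    Nonempty (G ≃g SimpleGraph.completeGraph (Fin 2)) := by
  have hall : ∀ z, z = x ∨ z = y := by
    intro z
    obtain ⟨w⟩ := hG.preconnected x z
    by_contra hz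
    obtain ⟨e, -, h1, h2⟩ := w.exists_boundary_dart {z | z = x ∨ z = y} (Or.inl rfl) hz
    rcases h1 with h1 | h1
    · exact h2 (Or.inr (hx _ (h1 ▸ e.adj)))
    · exact h2 (Or.inl (hy _ (h1 ▸ e.adj)))
  have hadj : ∀ u v, G.Adj u v ↔ u ≠ v := by
    intro u v
    refine ⟨fun h => h.ne, fun h => ?_⟩
    rcases hall u with rfl | rfl <;> rcases hall v with rfl | rfl
    · exact absurd rfl h
    · exact hxy
    · exact hxy.symm
    · exact absurd rfl h
  have hcard : Nat.card V = 2 := Nat.card_eq_two_iff.2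
    ⟨x, y, hxy.ne, Set.eq_univ_of_forall fun z => by simpa using hall z⟩
  have : Finite V := Nat.finite_of_card_ne_zero (by omega)
  refine ⟨⟨Finite.equivFinOfCardEq hcard, fun {u v} => ?_⟩⟩
  rw [hadj, SimpleGraph.completeGraph_eq_top, SimpleGraph.top_adj]
  exact (Equiv.injective _).ne_iff

/-- Solutions on the connected components are put together. -/
theorem exists_solution [Fintype V] (G : SimpleGraph V)
    (hG : ∀ C : G.ConnectedComponent,
      ¬ Nonempty (C.toSimpleGraph ≃g SimpleGraph.completeGraph (Fin 2))) :
    ∃ ω, IsSolution G ω := by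
  have hC : ∀ C : G.ConnectedComponent, ∃ ω, IsSolution C.toSimpleGraph ω := fun C =>
    exists_solution_of_connected C.connected_toSimpleGraph fun x y hxy hx => by
      by_contra hcon
      push Not at hcon
      exact hG C (nonempty_iso_completeGraph_two C.connected_toSimpleGraph hxy hx
        fun z hyz => by_contra fun hz => hcon z hz hyz)
  choose ω hω using hC
  set F : (Σ C : G.ConnectedComponent, Sym2 C) → Sym2 V := fun p => p.2.map Subtype.val with hF
  have hinj : Function.Injective F := by
    rintro ⟨C, e⟩ ⟨C', e'⟩ h
    have hCC : C = C' := by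
      induction e using Sym2.ind with
      | _ x y =>
        have hx : (x : V) ∈ F ⟨C', e'⟩ := h ▸ (Sym2.mem_map.2 ⟨x, Sym2.mem_mk_left x y, rfl⟩)
        obtain ⟨z, -, hz⟩ := Sym2.mem_map.1 hx
        exact x.2.symm.trans ((congrArg G.connectedComponentMk hz).symm.trans z.2)
    subst hCC
    have hee : e = e' := Sym2.map.injective Subtype.val_injective h
    rw [hee]
  refine ⟨Function.extend F (fun p => ω p.1 p.2) 1, fun e => ?_, fun u v huv => ?_⟩
  · by_cases he : ∃ p, F p = e
    · obtain ⟨p, rfl⟩ := he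
      rw [hinj.extend_apply]
      exact (hω p.1).1 p.2
    · rw [Function.extend_apply' _ _ _ he]
      exact ⟨le_rfl, by norm_num⟩
  · have hdeg : ∀ (C : G.ConnectedComponent) (x : C),
        wdeg G (Function.extend F (fun p => ω p.1 p.2) 1) x = wdeg C.toSimpleGraph (ω C) x := by
      intro C x
      refine (Fintype.sum_of_injective Subtype.val Subtype.val_injective _ _ (fun y hy => ?_)
        fun y => ?_).symm
      · refine if_neg fun hxy => hy ⟨⟨y, ?_⟩, rfl⟩
        exact (SimpleGraph.ConnectedComponent.connectedComponentMk_eq_of_adj hxy).symm.trans x.2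
      · have : C.toSimpleGraph.Adj x y ↔ G.Adj x y := Iff.rfl
        simp only [this]
        congr 1
        exact (hinj.extend_apply (fun p => ω p.1 p.2) 1 ⟨C, s(x, y)⟩).symm
    have hv : v ∈ G.connectedComponentMk u :=
      (SimpleGraph.ConnectedComponent.connectedComponentMk_eq_of_adj huv).symm
    have := (hω (G.connectedComponentMk u)).2 ⟨u, rfl⟩ ⟨v, hv⟩ huv
    rwa [← hdeg, ← hdeg] at this

end Components

end OneTwoThree

theorem theorem1 {V : Type*} [Fintype V] (G : SimpleGraph V) [DecidableRel G.Adj]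
    (hG : ∀ C : G.ConnectedComponent, ¬ Nonempty (C.toSimpleGraph ≃g SimpleGraph.completeGraph (Fin 2))) :
    ∃ ω : G.edgeSet → ℕ, (∀ e, ω e ∈ ({1, 2, 3} : Set ℕ)) ∧
      ∀ v w : V, G.Adj v w → weightedDegree G ω v ≠ weightedDegree G ω w := by
  obtain ⟨ω, hω, hne⟩ := OneTwoThree.exists_solution G hG
  have hdeg : ∀ v, (weightedDegree G (fun e => (ω e).toNat) v : ℤ) = OneTwoThree.wdeg G ω v := by
    intro v
    rw [weightedDegree, Nat.cast_sum]
    refine Fintype.sum_of_injective Subtype.val Subtype.val_injective _ _ (fun u hu => ?_) fun u => ?_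
    · exact if_neg fun h => hu ⟨⟨u, h⟩, rfl⟩
    · rw [if_pos ((G.mem_neighborSet v u).1 u.2)]
      exact Int.toNat_of_nonneg (by linarith [(hω s(v, (u : V))).1])
  refine ⟨fun e => (ω e).toNat, fun e => ?_, fun v w hvw h => hne v w hvw ?_⟩
  · have := hω e
    simp only [Set.mem_insert_iff, Set.mem_singleton_iff]
    omega
  · rw [← hdeg, ← hdeg, h]
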